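/- Let $\mathbf k$ be an algebraically closed field of characteristic $0$. Let $\mathrm{Alg}_2^{fd}$ be the bicategory whose objects are the finite-dimensional semisimple $\mathbf k$-algebras, whose $1$-morphisms $A\to B$ are the finite-dimensional $(A,B)$-bimodules, and whose $2$-morphisms are the intertwiners; the composite of ${}_AM_B$ and ${}_BN_C$ is $M\otimes_B N$, the identity of $A$ is ${}_AA_A$, and the associators and unitors are the canonical ones. For a bicategory $\mathcal A$, let $\mathcal A^{co}$ be $\mathcal A$ with reversed $2$-morphisms. A weak duality involution on $\mathcal A$ consists of a pseudofunctor $(-)^\circ:\mathcal A^{co}\to\mathcal A$, a pseudonatural adjoint equivalence $\mathfrak y: 1_{\mathcal A}\Rightarrow (-)^\circ\circ((-)^\circ)^{co}$, and an invertible modification $\zeta$ with components $\zeta_x:\mathfrak y_{x^\circ}\xrightarrow{\simeq}(\mathfrak y_x)^\circ$, such that for every object $x$ the $2$-morphism $\zeta_{x^\circ}:\mathfrak y_{x^{\circ\circ}}\Rightarrow(\mathfrak y_{x^\circ})^\circ$ whiskered with $\mathfrak y_x$ is equal to the pasting of the pseudonaturality cell $\mathfrak y_{\mathfrak y_x}:\mathfrak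 y_{x^{\circ\circ}}\circ\mathfrak y_x\cong(\mathfrak y_x)^{\circ\circ}\circ\mathfrak y_x$ with $(\zeta_x)^\circ:(\mathfrak y_x)^{\circ\circ}\Rightarrow(\mathfrak y_{x^\circ})^\circ$. Theorem. The following data form a weak duality involution on $\mathrm{Alg}_2^{fd}$. (1) $A^\circ=A^{op}$; for a bimodule ${}_AM_B$, $M^\circ=\mathrm{hom}_B(M,B)$ (right $B$-linear maps), regarded as an $(A^{op},B^{op})$-bimodule by $(af)(m)=f(am)$ and $(fb)(m)=b\,f(m)$; for an intertwiner $f$, $f^\circ=f^*$ (precomposition with $f$). The unit constraint $1_A^\circ=\mathrm{hom}_A(A,A)\to A^{op}=1_{A^\circ}$ is $f\mapsto f(1)$, and the composition constraint $(M\otimes_BN)^\circ\to M^\circ\otimes_{B^{op}}N^\circ$ is the inverse of the isomorphism $f\otimes g\mapsto\big(m\otimes n\mapsto g(f(m)\,n)\big)$. (2) $\mathfrak y_A:A\to A^{\circ\circ}$ is the identity bimodule ${}_AA_A$, where $A^{\circ\circ}=(A^{op})^{op}$ is identified with $A$; for ${}_AM_B$, the $2$-morphism $\mathfrak y_M: M\otimes_BB\to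 A\otimes_AM^{\circ\circ}$ is the composite of $M\otimes_BB\cong M$, the double-dual isomorphism $\psi_M:M\to M^{\circ\circ}=\mathrm{hom}_{B^{op}}(\mathrm{hom}_B(M,B),B^{op})$, $\psi_M(m)(g)=g(m)$, and $M^{\circ\circ}\cong A\otimes_AM^{\circ\circ}$. (3) $\zeta_A:\mathfrak y_{A^\circ}=A^{op}\to\mathrm{hom}_A(A,A)=(\mathfrak y_A)^\circ$ is $x\mapsto(a\mapsto xa)$, the inverse of $f\mapsto f(1)$. -/

import Mathlib

universe w v u w₁ v₁ u₁

namespace DualityInvolution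

open CategoryTheory Bicategory Opposite
open scoped Pseudofunctor.StrongTrans

/-- The objects of the bicategory `B^co`. -/
structure Co (B : Type u) where
  as : B

section
variable (B : Type u) [Bicategory.{w, v} B]

/-- The bicategory `B^co`, with the same objects as `B` and with `B^co(x, y) = B(x, y)ᵒᵖ`. -/
instance : Bicategory.{w, v} (Co B) where
  Hom x y := (x.as ⟶ y.as)ᵒᵖ
  id x := op (𝟙 x.as)
  comp f g := op (f.unop ≫ g.unop)
  homCategory x y := inferInstanceAs (Category (x.as ⟶ y.as)ᵒᵖ)
  whiskerLeft f _ _ η := (f.unop ◁ η.unop).op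
  whiskerRight η h := (η.unop ▷ h.unop).op
  associator f g h := (α_ f.unop g.unop h.unop).symm.op
  leftUnitor f := (λ_ f.unop).symm.op
  rightUnitor f := (ρ_ f.unop).symm.op
  whiskerLeft_id _ _ := Quiver.Hom.unop_inj (whiskerLeft_id _ _)
  whiskerLeft_comp _ _ _ _ _ _ := Quiver.Hom.unop_inj (whiskerLeft_comp _ _ _)
  id_whiskerLeft _ := Quiver.Hom.unop_inj (by simp)
  comp_whiskerLeft _ _ _ _ _ := Quiver.Hom.unop_inj (by simp)
  id_whiskerRight _ _ := Quiver.Hom.unop_inj (id_whiskerRight _ _)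
  comp_whiskerRight _ _ _ := Quiver.Hom.unop_inj (comp_whiskerRight _ _ _)
  whiskerRight_id _ := Quiver.Hom.unop_inj (by simp)
  whiskerRight_comp _ _ _ := Quiver.Hom.unop_inj (by simp)
  whisker_assoc _ _ _ _ _ := Quiver.Hom.unop_inj (by simp)
  whisker_exchange _ _ := Quiver.Hom.unop_inj (whisker_exchange _ _).symm
  pentagon _ _ _ _ := Quiver.Hom.unop_inj (by simp)
  triangle _ _ := Quiver.Hom.unop_inj (by simp)
end

namespace Co
variable {B : Type u} [Bicategory.{w, v} B]

/-- A 1-morphism of `B` as a 1-morphism of `B^co`. -/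
abbrev op1 {a b : B} (f : a ⟶ b) : (⟨a⟩ : Co B) ⟶ ⟨b⟩ := Opposite.op f

/-- A 1-morphism of `B^co` as a 1-morphism of `B`. -/
abbrev unop1 {x z : Co B} (f : x ⟶ z) : x.as ⟶ z.as := Opposite.unop f

/-- A 2-morphism of `B` as a 2-morphism of `B^co`, in the reverse direction. -/
abbrev op2 {a b : B} {f g : a ⟶ b} (η : f ⟶ g) : op1 g ⟶ op1 f := Quiver.Hom.op η

/-- An invertible 2-morphism of `B` as an invertible 2-morphism of `B^co`, oriented so that
its `hom` is the inverse of the given one. -/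
abbrev opIso {a b : B} {f g : a ⟶ b} (e : f ≅ g) : op1 f ≅ op1 g := e.symm.op

end Co

section
variable {B : Type u} [Bicategory.{w, v} B] {C : Type u₁} [Bicategory.{w₁, v₁} C]

theorem co_hom_ext {x z : Co B} {f g : x ⟶ z} {η θ : f ⟶ g}
    (h : Quiver.Hom.unop η = Quiver.Hom.unop θ) : η = θ := Quiver.Hom.unop_inj h

/-- For a pseudofunctor `F : B^co ⥤ C`, the pseudofunctor `F^co : B ⥤ C^co`. -/
def coFunctor (F : Co B ⥤ᵖ C) : B ⥤ᵖ Co C where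
  obj x := ⟨F.obj ⟨x⟩⟩
  map f := Co.op1 (F.map (Co.op1 f))
  map₂ η := Co.op2 (F.map₂ (Co.op2 η))
  map₂_id f := congrArg Quiver.Hom.op (F.map₂_id (Co.op1 f))
  map₂_comp η θ := congrArg Quiver.Hom.op (F.map₂_comp (Co.op2 θ) (Co.op2 η))
  mapId x := Co.opIso (F.mapId ⟨x⟩)
  mapComp f g := Co.opIso (F.mapComp (Co.op1 f) (Co.op1 g))
  map₂_whisker_left f _ _ η := co_hom_ext <| by
    refine (F.map₂_whisker_left (Co.op1 f) (Co.op2 η)).trans ?_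
    exact (Category.assoc _ _ _).symm
  map₂_whisker_right η h := co_hom_ext <| by
    refine (F.map₂_whisker_right (Co.op2 η) (Co.op1 h)).trans ?_
    exact (Category.assoc _ _ _).symm
  map₂_associator f g h := co_hom_ext <| by
    have := congrArg Iso.inv (show F.map₂Iso (α_ (Co.op1 f) (Co.op1 g) (Co.op1 h)) =
      F.mapComp (Co.op1 f ≫ Co.op1 g) (Co.op1 h) ≪≫
        whiskerRightIso (F.mapComp (Co.op1 f) (Co.op1 g)) (F.map (Co.op1 h)) ≪≫
        α_ _ _ _ ≪≫ whiskerLeftIso (F.map (Co.op1 f)) (F.mapComp (Co.op1 g) (Co.op1 h)).symm ≪≫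
        (F.mapComp (Co.op1 f) (Co.op1 g ≫ Co.op1 h)).symm from
          Iso.ext (F.map₂_associator _ _ _))
    exact this
  map₂_left_unitor f := co_hom_ext <| by
    have := congrArg Iso.inv (show F.map₂Iso (λ_ (Co.op1 f)) =
      F.mapComp (𝟙 _) (Co.op1 f) ≪≫
        whiskerRightIso (F.mapId _) (F.map (Co.op1 f)) ≪≫ λ_ _ from
          Iso.ext (F.map₂_left_unitor _))
    exact this
  map₂_right_unitor f := co_hom_ext <| by
    have := congrArg Iso.inv (show F.map₂Iso (ρ_ (Co.op1 f)) =
      F.mapComp (Co.op1 f) (𝟙 _) ≪≫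
        whiskerLeftIso (F.map (Co.op1 f)) (F.mapId _) ≪≫ ρ_ _ from
          Iso.ext (F.map₂_right_unitor _))
    exact this

end

section
variable {B : Type u} [Bicategory.{w, v} B] {C : Type u₁} [Bicategory.{w₁, v₁} C]

theorem square_paste {x z x' z' : B} {f g : x ⟶ z} {p : x ⟶ x'} {q : z ⟶ z'}
    {f' g' g'' : x' ⟶ z'} {η : f ⟶ g} {η' : f' ⟶ g'} {n₁ : f ≫ q ⟶ p ≫ f'}
    {n₂ : g ≫ q ⟶ p ≫ g'} (h₂ : η ▷ q ≫ n₂ = n₁ ≫ p ◁ η') {τ : g' ⟶ g''}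
    {R : g ≫ q ⟶ p ≫ g''} (h₁ : n₂ ≫ p ◁ τ = R) : n₁ ≫ p ◁ (η' ≫ τ) = η ▷ q ≫ R := by
  rw [whiskerLeft_comp, ← Category.assoc, ← h₂, Category.assoc, h₁]

/-- The image under a pseudofunctor of a square which commutes up to an invertible 2-morphism. -/
def mapSquare (F : B ⥤ᵖ C) {x z x' z' : B} {f : x ⟶ z} {p : x ⟶ x'} {q : z ⟶ z'} {f' : x' ⟶ z'}
    (e : f ≫ q ≅ p ≫ f') : F.map f ≫ F.map q ≅ F.map p ≫ F.map f' :=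
  (F.mapComp f q).symm ≪≫ F.map₂Iso e ≪≫ F.mapComp p f'

theorem mapSquare_nat (F : B ⥤ᵖ C) {x z x' z' : B} {f g : x ⟶ z} {p : x ⟶ x'} {q : z ⟶ z'}
    {f' g' : x' ⟶ z'} {η : f ⟶ g} {η' : f' ⟶ g'} {e : f ≫ q ≅ p ≫ f'} {e' : g ≫ q ≅ p ≫ g'}
    (h : η ▷ q ≫ e'.hom = e.hom ≫ p ◁ η') :
    F.map₂ η ▷ F.map q ≫ (mapSquare F e').hom = (mapSquare F e).hom ≫ F.map p ◁ F.map₂ η' := by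
  have h' := congrArg F.map₂ h
  simp only [F.map₂_comp, F.map₂_whisker_left, F.map₂_whisker_right, Category.assoc] at h'
  simp only [mapSquare, Iso.trans_hom, Iso.symm_hom, Category.assoc, PrelaxFunctor.map₂Iso_hom]
  rw [Iso.eq_inv_comp]
  rw [← cancel_mono (F.mapComp p g').inv]
  simpa using h'

theorem mapSquare_id (F : B ⥤ᵖ C) {x x' : B} {p : x ⟶ x'} {t : x' ⟶ x'} {τ : t ⟶ 𝟙 x'}
    {e : 𝟙 x ≫ p ≅ p ≫ t} (h : e.hom ≫ p ◁ τ = (λ_ p).hom ≫ (ρ_ p).inv) :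
    (mapSquare F e).hom ≫ F.map p ◁ (F.map₂ τ ≫ (F.mapId x').hom) =
      (F.mapId x).hom ▷ F.map p ≫ (λ_ (F.map p)).hom ≫ (ρ_ (F.map p)).inv := by
  have h' := congrArg F.map₂ h
  simp only [F.map₂_comp, F.map₂_whisker_left] at h'
  have h'' : F.map₂ e.hom ≫ (F.mapComp p t).hom ≫ F.map p ◁ F.map₂ τ =
      F.map₂ (λ_ p).hom ≫ F.map₂ (ρ_ p).inv ≫ (F.mapComp p (𝟙 x')).hom := by
    rw [← cancel_mono (F.mapComp p (𝟙 x')).inv]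
    simpa using h'
  simp only [mapSquare, Iso.trans_hom, Iso.symm_hom, Category.assoc, PrelaxFunctor.map₂Iso_hom,
    whiskerLeft_comp]
  have hρ : F.map₂ (ρ_ p).inv ≫ (F.mapComp p (𝟙 x')).hom ≫ F.map p ◁ (F.mapId x').hom =
      (ρ_ (F.map p)).inv := by
    rw [← PrelaxFunctor.map₂Iso_inv, Iso.inv_comp_eq, PrelaxFunctor.map₂Iso_hom,
      F.map₂_right_unitor]
    simp
  rw [reassoc_of% h'', hρ, Iso.inv_comp_eq, F.map₂_left_unitor]
  simp

theorem mapSquare_comp (F : B ⥤ᵖ C) {x z w x' z' w' : B} {f : x ⟶ z} {g : z ⟶ w} {p : x ⟶ x'}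
    {q : z ⟶ z'} {r : w ⟶ w'} {f' : x' ⟶ z'} {g' : z' ⟶ w'} {t : x' ⟶ w'} {κ : t ⟶ f' ≫ g'}
    {ef : f ≫ q ≅ p ≫ f'} {eg : g ≫ r ≅ q ≫ g'} {e : (f ≫ g) ≫ r ≅ p ≫ t}
    (h : e.hom ≫ p ◁ κ = (α_ _ _ _).hom ≫ f ◁ eg.hom ≫ (α_ _ _ _).inv ≫ ef.hom ▷ g' ≫
      (α_ _ _ _).hom) :
    (mapSquare F e).hom ≫ F.map p ◁ (F.map₂ κ ≫ (F.mapComp f' g').hom) =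
      (F.mapComp f g).hom ▷ F.map r ≫ (α_ _ _ _).hom ≫ F.map f ◁ (mapSquare F eg).hom ≫
        (α_ _ _ _).inv ≫ (mapSquare F ef).hom ▷ F.map g' ≫ (α_ _ _ _).hom := by
  have h' := congrArg F.map₂ h
  simp only [F.map₂_comp, F.map₂_whisker_left] at h'
  have h'' : F.map₂ e.hom ≫ (F.mapComp p t).hom ≫ F.map p ◁ F.map₂ κ =
      F.map₂ ((α_ _ _ _).hom ≫ f ◁ eg.hom ≫ (α_ _ _ _).inv ≫ ef.hom ▷ g' ≫
      (α_ _ _ _).hom) ≫ (F.mapComp p (f' ≫ g')).hom := by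
    rw [← cancel_mono (F.mapComp p (f' ≫ g')).inv]
    simpa using h'
  simp only [mapSquare, Iso.trans_hom, Iso.symm_hom, Category.assoc, PrelaxFunctor.map₂Iso_hom,
    whiskerLeft_comp, comp_whiskerRight]
  rw [reassoc_of% h'', Iso.inv_comp_eq]
  have hα : (F.mapComp f (q ≫ g')).inv ≫ F.map₂ (α_ f q g').inv ≫ (F.mapComp (f ≫ q) g').hom =
      F.map f ◁ (F.mapComp q g').hom ≫ (α_ _ _ _).inv ≫ (F.mapComp f q).inv ▷ F.map g' := by
    rw [← PrelaxFunctor.map₂Iso_inv, Iso.inv_comp_eq, Iso.inv_comp_eq, PrelaxFunctor.map₂Iso_hom,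
      F.map₂_associator]
    simp
  simp [reassoc_of% hα]

/-- Commuting squares, inverted and read in `B^co`. -/
theorem co_square_nat {x z x' z' : B} {f g : x ⟶ z} {p : x ⟶ x'}
    {q : z ⟶ z'} {f' g' : x' ⟶ z'} {η : f ⟶ g} {η' : f' ⟶ g'} {e : f ≫ q ≅ p ≫ f'}
    {e' : g ≫ q ≅ p ≫ g'} (h : η ▷ q ≫ e'.hom = e.hom ≫ p ◁ η') :
    p ◁ η' ≫ e'.inv = e.inv ≫ η ▷ q := by
  rw [Iso.comp_inv_eq, Category.assoc, h, Iso.inv_hom_id_assoc]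

theorem co_square_id {x x' : B} {p : x ⟶ x'} {t : x' ⟶ x'} {τ : t ≅ 𝟙 x'}
    {e : 𝟙 x ≫ p ≅ p ≫ t} (h : e.hom ≫ p ◁ τ.hom = 𝟙 (𝟙 x) ▷ p ≫ (λ_ p).hom ≫ (ρ_ p).inv) :
    p ◁ τ.inv ≫ e.inv = (ρ_ p).hom ≫ (λ_ p).inv := by
  have : e ≪≫ whiskerLeftIso p τ = λ_ p ≪≫ (ρ_ p).symm := Iso.ext (by simpa using h)
  exact congrArg Iso.inv this

theorem co_square_comp {x z w x' z' w' : B} {f : x ⟶ z} {g : z ⟶ w} {p : x ⟶ x'}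
    {q : z ⟶ z'} {r : w ⟶ w'} {f' : x' ⟶ z'} {g' : z' ⟶ w'} {t : x' ⟶ w'} {κ : t ≅ f' ≫ g'}
    {ef : f ≫ q ≅ p ≫ f'} {eg : g ≫ r ≅ q ≫ g'} {e : (f ≫ g) ≫ r ≅ p ≫ t}
    (h : e.hom ≫ p ◁ κ.hom = 𝟙 (f ≫ g) ▷ r ≫ (α_ _ _ _).hom ≫ f ◁ eg.hom ≫ (α_ _ _ _).inv ≫
      ef.hom ▷ g' ≫ (α_ _ _ _).hom) :
    p ◁ κ.inv ≫ e.inv = ((((α_ _ _ _).inv ≫ ef.inv ▷ g') ≫ (α_ _ _ _).hom) ≫ f ◁ eg.inv) ≫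
      (α_ _ _ _).inv := by
  have : e ≪≫ whiskerLeftIso p κ = α_ _ _ _ ≪≫ whiskerLeftIso f eg ≪≫ (α_ _ _ _).symm ≪≫
      whiskerRightIso ef g' ≪≫ α_ _ _ _ := Iso.ext (by simpa using h)
  exact congrArg Iso.inv this

end

section
variable {B : Type u} [Bicategory.{w, v} B]

/-- The composite `B ⥤ B^co ⥤ B`, which sends `x` to `x°°`. -/
abbrev double (F : Co B ⥤ᵖ B) : B ⥤ᵖ B := (coFunctor F).comp F

variable (F : Co B ⥤ᵖ B) (y : Pseudofunctor.id B ⟶ double F)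

/-- The whiskering of `y` with `F`, with components `y_{x°} : x° ⟶ x°°°`. -/
def whiskerObj : F ⟶ F.comp (double F) where
  app x := y.app (F.obj x)
  naturality f := y.naturality (F.map f)
  naturality_naturality η := y.naturality_naturality (F.map₂ η)
  naturality_id x := square_paste (y.naturality_naturality (F.mapId x).hom)
    ((y.naturality_id (F.obj x)).trans
      ((congrArg (· ≫ _) (id_whiskerRight _ _)).trans (Category.id_comp _)))
  naturality_comp f g := square_paste (y.naturality_naturality (F.mapComp f g).hom)
    ((y.naturality_comp (F.map f) (F.map g)).trans
      ((congrArg (· ≫ _) (id_whiskerRight _ _)).trans (Category.id_comp _)))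

/-- The whiskering of `F` with `y^co`, with components `(y_x)° : x° ⟶ x°°°`. -/
def whiskerMap : F ⟶ F.comp (double F) where
  app x := F.map (Co.op1 (y.app x.as))
  naturality {x z} f := mapSquare F (Co.opIso (y.naturality (Co.unop1 f)))
  naturality_naturality η := mapSquare_nat F
    (co_hom_ext (co_square_nat (y.naturality_naturality (Quiver.Hom.unop η))).symm)
  naturality_id x := by
    have h := mapSquare_id F (e := Co.opIso (y.naturality (𝟙 x.as)))
      (τ := (coFunctor F).map₂ (F.mapId x).hom ≫ ((coFunctor F).mapId (F.obj x)).hom)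
      (co_hom_ext (co_square_id (y.naturality_id x.as)))
    rw [F.map₂_comp, Category.assoc] at h
    exact h
  naturality_comp f g := by
    have h := mapSquare_comp F (f := f) (g := g)
      (e := Co.opIso (y.naturality (Co.unop1 f ≫ Co.unop1 g)))
      (ef := Co.opIso (y.naturality (Co.unop1 f)))
      (eg := Co.opIso (y.naturality (Co.unop1 g)))
      (κ := (coFunctor F).map₂ (F.mapComp f g).hom ≫
        ((coFunctor F).mapComp (F.map f) (F.map g)).hom)
      (co_hom_ext (co_square_comp (y.naturality_comp (Co.unop1 f) (Co.unop1 g))))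
    rw [F.map₂_comp, Category.assoc] at h
    exact h

end

section
variable (B : Type u) [Bicategory.{w, v} B]

/-- A weak duality involution on a bicategory `B`. -/
structure WeakDualityInvolution where
  /-- The pseudofunctor `(-)° : B^co ⥤ B`. -/
  dual : Co B ⥤ᵖ B
  /-- The pseudonatural adjoint equivalence `y : 1 ⟶ (-)°°`, an adjoint equivalence in the
  bicategory of pseudofunctors, pseudonatural transformations and modifications. -/
  y : Pseudofunctor.id B ≌ double dual
  /-- The invertible modification `ζ`, with components `ζ_x : y_{x°} ≅ (y_x)°`. -/
  zeta : whiskerObj dual y.hom ≅ whiskerMap dual y.hom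
  /-- The 2-morphism `ζ_{x°} : y_{x°°} ⟶ (y_{x°})°` precomposed with `y_x` agrees with the pasting
  of the pseudonaturality square of `y` at `y_x` and of `(ζ_x)° : (y_x)°° ⟶ (y_{x°})°`. -/
  coherence (x : B) :
    y.hom.app x ◁ zeta.hom.as.app ⟨dual.obj ⟨x⟩⟩ =
      (y.hom.naturality (y.hom.app x)).hom ≫
        y.hom.app x ◁ dual.map₂ (Co.op2 (zeta.hom.as.app ⟨x⟩))

/-- The data, without any laws, which underlie a weak duality involution: the assignments of the
pseudofunctor on objects, 1-morphisms and 2-morphisms, its unit and composition constraints, the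
components of `y` on objects and 1-morphisms, and the components of `ζ`. -/
structure DualityData where
  obj : B → B
  map {a b : B} (f : a ⟶ b) : obj a ⟶ obj b
  map₂ {a b : B} {f g : a ⟶ b} (η : f ⟶ g) : map g ⟶ map f
  mapId (a : B) : map (𝟙 a) ⟶ 𝟙 (obj a)
  mapComp {a b c : B} (f : a ⟶ b) (g : b ⟶ c) : map f ≫ map g ⟶ map (f ≫ g)
  y (a : B) : a ⟶ obj (obj a)
  yNat {a b : B} (f : a ⟶ b) : f ≫ y b ⟶ y a ≫ map (map f)
  zeta (a : B) : y (obj a) ⟶ map (y a)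

variable {B}

/-- The data which underlie a weak duality involution. -/
def WeakDualityInvolution.toData (W : WeakDualityInvolution B) : DualityData B where
  obj a := (W.dual.obj ⟨a⟩)
  map f := W.dual.map (Co.op1 f)
  map₂ η := W.dual.map₂ (Co.op2 η)
  mapId a := (W.dual.mapId ⟨a⟩).hom
  mapComp f g := (W.dual.mapComp (Co.op1 f) (Co.op1 g)).inv
  y a := W.y.hom.app a
  yNat f := (W.y.hom.naturality f).hom
  zeta a := W.zeta.hom.as.app ⟨a⟩

end

end DualityInvolution

namespace MoritaTwo

open CategoryTheory Bicategory TensorProduct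

/-- A finite-dimensional semisimple algebra over the field `k`. -/
structure SSAlg (k : Type u) [Field k] where
  carrier : Type v
  [ring : Ring carrier]
  [algebra : Algebra k carrier]
  [finite : Module.Finite k carrier]
  [semisimple : IsSemisimpleRing carrier]

namespace SSAlg

instance (k : Type u) [Field k] : CoeSort (SSAlg.{v} k) (Type v) := ⟨carrier⟩

attribute [instance] ring algebra finite semisimple

/-- The opposite algebra. -/
def opp {k : Type u} [Field k] (A : SSAlg.{v} k) : SSAlg.{v} k where
  carrier := (A : Type v)ᵐᵒᵖ

/-- An element of `A` as an element of the opposite algebra. -/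
def toOpp {k : Type u} [Field k] (A : SSAlg.{v} k) : A ≃ₗ[k] A.opp := MulOpposite.opLinearEquiv k

@[simp] theorem toOpp_mul {k : Type u} [Field k] (A : SSAlg.{v} k) (a b : A) :
    A.toOpp (a * b) = A.toOpp b * A.toOpp a := rfl

@[simp] theorem toOpp_one {k : Type u} [Field k] (A : SSAlg.{v} k) : A.toOpp 1 = 1 := rfl

@[simp] theorem toOpp_symm_mul {k : Type u} [Field k] (A : SSAlg.{v} k) (a b : A.opp) :
    A.toOpp.symm (a * b) = A.toOpp.symm b * A.toOpp.symm a := rfl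

@[simp] theorem toOpp_symm_one {k : Type u} [Field k] (A : SSAlg.{v} k) :
    A.toOpp.symm 1 = 1 := rfl

end SSAlg

variable {k : Type u} [Field k]

/-- A finite-dimensional `(A, B)`-bimodule: a finite-dimensional `k`-vector space with a left
action `lact a m` (written `a m`) of `A` and a right action `ract b m` (written `m b`) of `B`,
both `k`-bilinear, unital and associative, which commute with one another. -/
structure BiMod (A B : SSAlg.{v} k) where
  carrier : Type v
  [addCommGroup : AddCommGroup carrier]
  [module : Module k carrier]
  [finite : Module.Finite k carrier]
  lact : A →ₗ[k] carrier →ₗ[k] carrier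
  ract : B →ₗ[k] carrier →ₗ[k] carrier
  lact_one : ∀ m, lact 1 m = m
  lact_mul : ∀ a a' m, lact (a * a') m = lact a (lact a' m)
  ract_one : ∀ m, ract 1 m = m
  ract_mul : ∀ b b' m, ract (b * b') m = ract b' (ract b m)
  ract_lact : ∀ a b m, ract b (lact a m) = lact a (ract b m)

namespace BiMod

instance (A B : SSAlg.{v} k) : CoeSort (BiMod A B) (Type v) := ⟨carrier⟩

attribute [instance] addCommGroup module finite
attribute [simp] lact_one lact_mul ract_one ract_mul ract_lact

/-- An intertwiner of `(A, B)`-bimodules. -/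
@[ext]
structure Intertwiner {A B : SSAlg.{v} k} (M N : BiMod A B) where
  lin : M →ₗ[k] N
  map_lact : ∀ a m, lin (M.lact a m) = N.lact a (lin m)
  map_ract : ∀ b m, lin (M.ract b m) = N.ract b (lin m)

attribute [simp] Intertwiner.map_lact Intertwiner.map_ract

instance (A B : SSAlg.{v} k) : Category (BiMod A B) where
  Hom M N := Intertwiner M N
  id M := ⟨LinearMap.id, fun _ _ => rfl, fun _ _ => rfl⟩
  comp f g := ⟨g.lin ∘ₗ f.lin, fun _ _ => by simp, fun _ _ => by simp⟩

section

variable {A B C D E : SSAlg.{v} k}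

@[ext]
theorem hom_ext {M N : BiMod A B} {f g : M ⟶ N} (h : f.lin = g.lin) : f = g :=
  Intertwiner.ext h

@[simp] theorem id_lin (M : BiMod A B) : Intertwiner.lin (𝟙 M) = LinearMap.id := rfl

@[simp] theorem comp_lin {M N P : BiMod A B} (f : M ⟶ N) (g : N ⟶ P) :
    Intertwiner.lin (f ≫ g) = g.lin ∘ₗ f.lin := rfl

/-- The algebra `A` regarded as an `(A, A)`-bimodule. -/
def unit (A : SSAlg.{v} k) : BiMod A A where
  carrier := A
  lact := LinearMap.mul k A
  ract := (LinearMap.mul k A).flip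
  lact_one := by simp
  lact_mul := by simp [mul_assoc]
  ract_one := by simp
  ract_mul := by simp [mul_assoc]
  ract_lact := by simp [mul_assoc]

/-- An element of `A` as an element of the bimodule `A`. -/
def ofAlg (A : SSAlg.{v} k) : A ≃ₗ[k] unit A := LinearEquiv.refl k A

@[simp] theorem lact_ofAlg (a x : A) : (unit A).lact a (ofAlg A x) = ofAlg A (a * x) := rfl

@[simp] theorem ract_ofAlg (a x : A) : (unit A).ract a (ofAlg A x) = ofAlg A (x * a) := rfl

/-- The relations `m b ⊗ n = m ⊗ b n` which define the tensor product over `B`. -/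
def balRel (M : BiMod A B) (N : BiMod B C) : Submodule k (M ⊗[k] N) :=
  Submodule.span k {t | ∃ m b n, t = M.ract b m ⊗ₜ[k] n - m ⊗ₜ[k] N.lact b n}

/-- The vector space `M ⊗_B N`. -/
def BalTensor (M : BiMod A B) (N : BiMod B C) : Type v := (M ⊗[k] N) ⧸ balRel M N

instance (M : BiMod A B) (N : BiMod B C) : AddCommGroup (BalTensor M N) :=
  inferInstanceAs (AddCommGroup ((M ⊗[k] N) ⧸ balRel M N))

instance (M : BiMod A B) (N : BiMod B C) : Module k (BalTensor M N) :=
  inferInstanceAs (Module k ((M ⊗[k] N) ⧸ balRel M N))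

instance (M : BiMod A B) (N : BiMod B C) : Module.Finite k (BalTensor M N) :=
  inferInstanceAs (Module.Finite k ((M ⊗[k] N) ⧸ balRel M N))

/-- The class of `m ⊗ n`, as a bilinear map. -/
def tmk (M : BiMod A B) (N : BiMod B C) : M →ₗ[k] N →ₗ[k] BalTensor M N :=
  (TensorProduct.mk k M N).compr₂ (balRel M N).mkQ

theorem tmk_bal {M : BiMod A B} {N : BiMod B C} (m : M) (b : B) (n : N) :
    tmk M N (M.ract b m) n = tmk M N m (N.lact b n) := by
  refine (Submodule.Quotient.eq (balRel M N)).2 (Submodule.subset_span ⟨m, b, n, rfl⟩)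

/-- The linear map out of `M ⊗_B N` induced by a balanced bilinear map. -/
def tlift {M : BiMod A B} {N : BiMod B C} {P : Type w} [AddCommGroup P] [Module k P]
    (f : M →ₗ[k] N →ₗ[k] P) (h : ∀ m b n, f (M.ract b m) n = f m (N.lact b n)) :
    BalTensor M N →ₗ[k] P :=
  (balRel M N).liftQ (TensorProduct.lift f) (by
    refine Submodule.span_le.2 ?_
    rintro _ ⟨m, b, n, rfl⟩
    simp [h])

@[simp] theorem tlift_tmk {M : BiMod A B} {N : BiMod B C} {P : Type w} [AddCommGroup P]
    [Module k P] (f : M →ₗ[k] N →ₗ[k] P) (h : ∀ m b n, f (M.ract b m) n = f m (N.lact b n))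
    (m : M) (n : N) : tlift f h (tmk M N m n) = f m n := rfl

theorem tensor_ext {M : BiMod A B} {N : BiMod B C} {P : Type w} [AddCommGroup P] [Module k P]
    {f g : BalTensor M N →ₗ[k] P} (h : ∀ m n, f (tmk M N m n) = g (tmk M N m n)) : f = g := by
  refine Submodule.linearMap_qext _ (TensorProduct.ext' fun m n => h m n)

theorem tensor_ext_apply {M : BiMod A B} {N : BiMod B C} {P : Type w} [AddCommGroup P]
    [Module k P] {f g : BalTensor M N →ₗ[k] P}
    (h : ∀ m n, f (tmk M N m n) = g (tmk M N m n)) (t : BalTensor M N) : f t = g t :=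
  LinearMap.congr_fun (tensor_ext h) t

/-- The left action `a (m ⊗ n) = a m ⊗ n`. -/
def balLact (M : BiMod A B) (N : BiMod B C) : A →ₗ[k] BalTensor M N →ₗ[k] BalTensor M N where
  toFun a := tlift ((tmk M N).comp (M.lact a)) fun m b n => by simp [← tmk_bal]
  map_add' _ _ := tensor_ext fun _ _ => by simp
  map_smul' _ _ := tensor_ext fun _ _ => by simp

/-- The right action `(m ⊗ n) c = m ⊗ n c`. -/
def balRact (M : BiMod A B) (N : BiMod B C) : C →ₗ[k] BalTensor M N →ₗ[k] BalTensor M N where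
  toFun c := tlift ((tmk M N).compl₂ (N.ract c)) fun m b n => by simp [tmk_bal]
  map_add' _ _ := tensor_ext fun _ _ => by simp
  map_smul' _ _ := tensor_ext fun _ _ => by simp

@[simp] theorem balLact_tmk (M : BiMod A B) (N : BiMod B C) (a : A) (m : M) (n : N) :
    balLact M N a (tmk M N m n) = tmk M N (M.lact a m) n := rfl

@[simp] theorem balRact_tmk (M : BiMod A B) (N : BiMod B C) (c : C) (m : M) (n : N) :
    balRact M N c (tmk M N m n) = tmk M N m (N.ract c n) := rfl

/-- The composite `(A, C)`-bimodule `M ⊗_B N`. -/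
def tensor (M : BiMod A B) (N : BiMod B C) : BiMod A C where
  carrier := BalTensor M N
  lact := balLact M N
  ract := balRact M N
  lact_one := tensor_ext_apply (f := balLact M N 1) (g := LinearMap.id) fun _ _ => by simp
  lact_mul a a' := tensor_ext_apply (f := balLact M N (a * a'))
    (g := balLact M N a ∘ₗ balLact M N a') fun _ _ => by simp
  ract_one := tensor_ext_apply (f := balRact M N 1) (g := LinearMap.id) fun _ _ => by simp
  ract_mul b b' := tensor_ext_apply (f := balRact M N (b * b'))
    (g := balRact M N b' ∘ₗ balRact M N b) fun _ _ => by simp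
  ract_lact a b := tensor_ext_apply (f := balRact M N b ∘ₗ balLact M N a)
    (g := balLact M N a ∘ₗ balRact M N b) fun _ _ => by simp

/-- The class of `m ⊗ n` in the composite bimodule, as a bilinear map. -/
def tm (M : BiMod A B) (N : BiMod B C) : M →ₗ[k] N →ₗ[k] tensor M N := tmk M N

@[simp] theorem lact_tm (M : BiMod A B) (N : BiMod B C) (a : A) (m : M) (n : N) :
    (tensor M N).lact a (tm M N m n) = tm M N (M.lact a m) n := rfl

@[simp] theorem ract_tm (M : BiMod A B) (N : BiMod B C) (c : C) (m : M) (n : N) :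
    (tensor M N).ract c (tm M N m n) = tm M N m (N.ract c n) := rfl

theorem tm_bal {M : BiMod A B} {N : BiMod B C} (m : M) (b : B) (n : N) :
    tm M N (M.ract b m) n = tm M N m (N.lact b n) := tmk_bal m b n

/-- The linear map out of the composite bimodule induced by a balanced bilinear map. -/
def lift {M : BiMod A B} {N : BiMod B C} {P : Type w} [AddCommGroup P] [Module k P]
    (f : M →ₗ[k] N →ₗ[k] P) (h : ∀ m b n, f (M.ract b m) n = f m (N.lact b n)) :
    tensor M N →ₗ[k] P := tlift f h

@[simp] theorem lift_tm {M : BiMod A B} {N : BiMod B C} {P : Type w} [AddCommGroup P]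
    [Module k P] (f : M →ₗ[k] N →ₗ[k] P) (h : ∀ m b n, f (M.ract b m) n = f m (N.lact b n))
    (m : M) (n : N) : lift f h (tm M N m n) = f m n := rfl

theorem lin_ext {M : BiMod A B} {N : BiMod B C} {P : Type w} [AddCommGroup P] [Module k P]
    {f g : tensor M N →ₗ[k] P} (h : ∀ m n, f (tm M N m n) = g (tm M N m n)) : f = g :=
  tensor_ext h

theorem lin_ext_apply {M : BiMod A B} {N : BiMod B C} {P : Type w} [AddCommGroup P]
    [Module k P] (f g : tensor M N →ₗ[k] P)
    (h : ∀ m n, f (tm M N m n) = g (tm M N m n)) (t : tensor M N) : f t = g t :=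
  tensor_ext_apply h t

theorem hom_ext₂ {M : BiMod A B} {N : BiMod B C} {P : BiMod A C} {f g : tensor M N ⟶ P}
    (h : ∀ m n, f.lin (tm M N m n) = g.lin (tm M N m n)) : f = g :=
  hom_ext (lin_ext h)

/-- The intertwiner out of `M ⊗_B N` induced by a bilinear map which is balanced over `B` and
compatible with the outer actions. -/
def desc {M : BiMod A B} {N : BiMod B C} {P : BiMod A C} (f : M →ₗ[k] N →ₗ[k] P)
    (h : ∀ m b n, f (M.ract b m) n = f m (N.lact b n))
    (hl : ∀ a m n, f (M.lact a m) n = P.lact a (f m n))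
    (hr : ∀ c m n, f m (N.ract c n) = P.ract c (f m n)) : tensor M N ⟶ P where
  lin := lift f h
  map_lact a := lin_ext_apply (lift f h ∘ₗ (tensor M N).lact a) (P.lact a ∘ₗ lift f h)
    fun m n => by simp [hl]
  map_ract c := lin_ext_apply (lift f h ∘ₗ (tensor M N).ract c) (P.ract c ∘ₗ lift f h)
    fun m n => by simp [hr]

@[simp] theorem desc_tm {M : BiMod A B} {N : BiMod B C} {P : BiMod A C} (f : M →ₗ[k] N →ₗ[k] P)
    (h hl hr) (m : M) (n : N) :
    (desc (M := M) (N := N) (P := P) f h hl hr).lin (tm M N m n) = f m n := rfl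

/-- `f ⊗ g` for intertwiners `f` and `g`. -/
def tensorHom {M M' : BiMod A B} {N N' : BiMod B C} (f : M ⟶ M') (g : N ⟶ N') :
    tensor M N ⟶ tensor M' N' :=
  desc ((tm M' N').compl₁₂ f.lin g.lin)
    (fun m b n => by simp [tm_bal]) (fun a m n => by simp) (fun c m n => by simp)

@[simp] theorem tensorHom_tm {M M' : BiMod A B} {N N' : BiMod B C} (f : M ⟶ M') (g : N ⟶ N')
    (m : M) (n : N) : (tensorHom f g).lin (tm M N m n) = tm M' N' (f.lin m) (g.lin n) := rfl

/-- The trilinear map `(m, n, p) ↦ m ⊗ (n ⊗ p)`. -/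
def tmRight (M : BiMod A B) (N : BiMod B C) (P : BiMod C D) :
    M →ₗ[k] N →ₗ[k] P →ₗ[k] tensor M (tensor N P) where
  toFun m := (tm N P).compr₂ (tm M (tensor N P) m)
  map_add' _ _ := by ext; simp
  map_smul' _ _ := by ext; simp

@[simp] theorem tmRight_apply (M : BiMod A B) (N : BiMod B C) (P : BiMod C D) (m : M) (n : N)
    (p : P) : tmRight M N P m n p = tm M (tensor N P) m (tm N P n p) := rfl

/-- The associator `(M ⊗ N) ⊗ P → M ⊗ (N ⊗ P)`, `(m ⊗ n) ⊗ p ↦ m ⊗ (n ⊗ p)`. -/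
def assocHom (M : BiMod A B) (N : BiMod B C) (P : BiMod C D) :
    tensor (tensor M N) P ⟶ tensor M (tensor N P) :=
  desc (lift (tmRight M N P) fun m b n => by ext p; simp [tm_bal])
    (fun t c p => lin_ext_apply
      (LinearMap.flip (lift (tmRight M N P) _) p ∘ₗ (tensor M N).ract c)
      (LinearMap.flip (lift (tmRight M N P) _) (P.lact c p)) (fun m n => by simp [tm_bal]) t)
    (fun a t p => lin_ext_apply
      (LinearMap.flip (lift (tmRight M N P) _) p ∘ₗ (tensor M N).lact a)
      ((tensor M (tensor N P)).lact a ∘ₗ LinearMap.flip (lift (tmRight M N P) _) p)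
      (fun m n => by simp) t)
    (fun d t p => lin_ext_apply
      (LinearMap.flip (lift (tmRight M N P) _) (P.ract d p))
      ((tensor M (tensor N P)).ract d ∘ₗ LinearMap.flip (lift (tmRight M N P) _) p)
      (fun m n => by simp) t)

@[simp] theorem assocHom_tm (M : BiMod A B) (N : BiMod B C) (P : BiMod C D) (m : M) (n : N)
    (p : P) : (assocHom M N P).lin (tm (tensor M N) P (tm M N m n) p) =
      tm M (tensor N P) m (tm N P n p) := rfl

/-- The trilinear map `(n, p, m) ↦ (m ⊗ n) ⊗ p`. -/
def tmLeft (M : BiMod A B) (N : BiMod B C) (P : BiMod C D) :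
    N →ₗ[k] P →ₗ[k] M →ₗ[k] tensor (tensor M N) P where
  toFun n := LinearMap.flip (tm (tensor M N) P ∘ₗ (tm M N).flip n)
  map_add' _ _ := by ext; simp
  map_smul' _ _ := by ext; simp

@[simp] theorem tmLeft_apply (M : BiMod A B) (N : BiMod B C) (P : BiMod C D) (m : M) (n : N)
    (p : P) : tmLeft M N P n p m = tm (tensor M N) P (tm M N m n) p := rfl

/-- The inverse associator `M ⊗ (N ⊗ P) → (M ⊗ N) ⊗ P`, `m ⊗ (n ⊗ p) ↦ (m ⊗ n) ⊗ p`. -/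
def assocInv (M : BiMod A B) (N : BiMod B C) (P : BiMod C D) :
    tensor M (tensor N P) ⟶ tensor (tensor M N) P :=
  desc (LinearMap.flip (lift (tmLeft M N P) fun n c p => by
      ext m; simp [← tm_bal (M := tensor M N)]))
    (fun m b t => lin_ext_apply
      (LinearMap.flip (lift (tmLeft M N P) _) (M.ract b m))
      (LinearMap.flip (lift (tmLeft M N P) _) m ∘ₗ (tensor N P).lact b)
      (fun n p => by simp [tm_bal]) t)
    (fun a m t => lin_ext_apply
      (LinearMap.flip (lift (tmLeft M N P) _) (M.lact a m))
      ((tensor (tensor M N) P).lact a ∘ₗ LinearMap.flip (lift (tmLeft M N P) _) m)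
      (fun n p => by simp) t)
    (fun d m t => lin_ext_apply
      (LinearMap.flip (lift (tmLeft M N P) _) m ∘ₗ (tensor N P).ract d)
      ((tensor (tensor M N) P).ract d ∘ₗ LinearMap.flip (lift (tmLeft M N P) _) m)
      (fun n p => by simp) t)

@[simp] theorem assocInv_tm (M : BiMod A B) (N : BiMod B C) (P : BiMod C D) (m : M) (n : N)
    (p : P) : (assocInv M N P).lin (tm M (tensor N P) m (tm N P n p)) =
      tm (tensor M N) P (tm M N m n) p := rfl

theorem hom_ext₃ {M : BiMod A B} {N : BiMod B C} {P : BiMod C D} {Q : BiMod A D}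
    {f g : tensor (tensor M N) P ⟶ Q}
    (h : ∀ m n p, f.lin (tm (tensor M N) P (tm M N m n) p) =
      g.lin (tm (tensor M N) P (tm M N m n) p)) : f = g :=
  hom_ext₂ fun t p => lin_ext_apply (f.lin ∘ₗ (tm (tensor M N) P).flip p)
    (g.lin ∘ₗ (tm (tensor M N) P).flip p) (fun m n => h m n p) t

theorem hom_ext₃' {M : BiMod A B} {N : BiMod B C} {P : BiMod C D} {Q : BiMod A D}
    {f g : tensor M (tensor N P) ⟶ Q}
    (h : ∀ m n p, f.lin (tm M (tensor N P) m (tm N P n p)) =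
      g.lin (tm M (tensor N P) m (tm N P n p))) : f = g :=
  hom_ext₂ fun m t => lin_ext_apply (f.lin ∘ₗ tm M (tensor N P) m)
    (g.lin ∘ₗ tm M (tensor N P) m) (fun n p => h m n p) t

/-- The associator. -/
def assoc (M : BiMod A B) (N : BiMod B C) (P : BiMod C D) :
    tensor (tensor M N) P ≅ tensor M (tensor N P) where
  hom := assocHom M N P
  inv := assocInv M N P
  hom_inv_id := hom_ext₃ fun _ _ _ => rfl
  inv_hom_id := hom_ext₃' fun _ _ _ => rfl

/-- The left unitor `A ⊗_A M ≅ M`, `a ⊗ m ↦ a m`. -/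
def lunit (M : BiMod A B) : tensor (unit A) M ≅ M where
  hom := desc (M.lact ∘ₗ (ofAlg A).symm) (fun a' a m => M.lact_mul a' a m)
    (fun a a' m => M.lact_mul a a' m) (fun b a m => (M.ract_lact a b m).symm)
  inv :=
    { lin := tm (unit A) M (ofAlg A 1)
      map_lact := fun a m => by simp [← tm_bal]
      map_ract := fun _ _ => rfl }
  hom_inv_id := hom_ext₂ fun a m =>
    (tm_bal (ofAlg A 1) ((ofAlg A).symm a) m).symm.trans (by simp)
  inv_hom_id := hom_ext (LinearMap.ext M.lact_one)

/-- The right unitor `M ⊗_B B ≅ M`, `m ⊗ b ↦ m b`. -/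
def runit (M : BiMod A B) : tensor M (unit B) ≅ M where
  hom := desc (LinearMap.flip (M.ract ∘ₗ (ofAlg B).symm))
    (fun m b b' => (M.ract_mul b b' m).symm)
    (fun a m b => M.ract_lact a b m) (fun b m b' => M.ract_mul b' b m)
  inv :=
    { lin := (tm M (unit B)).flip (ofAlg B 1)
      map_lact := fun _ _ => rfl
      map_ract := fun b m => by simp [tm_bal] }
  hom_inv_id := hom_ext₂ fun m b =>
    (tm_bal m ((ofAlg B).symm b) (ofAlg B 1)).trans (by simp)
  inv_hom_id := hom_ext (LinearMap.ext M.ract_one)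

end
end BiMod

open BiMod

/-- The Morita bicategory of finite-dimensional semisimple algebras: 1-morphisms `A ⟶ B` are
finite-dimensional `(A, B)`-bimodules, 2-morphisms are intertwiners, and the composite of
`M : A ⟶ B` with `N : B ⟶ C` is `M ⊗_B N`. -/
instance : Bicategory (SSAlg.{v} k) where
  Hom A B := BiMod A B
  id A := unit A
  comp M N := tensor M N
  homCategory A B := inferInstanceAs (Category (BiMod A B))
  whiskerLeft M _ _ g := tensorHom (𝟙 M) g
  whiskerRight f N := tensorHom f (𝟙 N)
  associator := assoc
  leftUnitor := lunit
  rightUnitor := runit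
  whiskerLeft_id _ _ := hom_ext₂ fun _ _ => rfl
  whiskerLeft_comp _ _ _ _ _ _ := hom_ext₂ fun _ _ => rfl
  id_whiskerLeft η := by
    rw [← Category.assoc, Iso.eq_comp_inv]
    exact hom_ext₂ fun a m => (η.map_lact a m).symm
  comp_whiskerLeft _ _ _ _ _ := hom_ext₃ fun _ _ _ => rfl
  id_whiskerRight _ _ := hom_ext₂ fun _ _ => rfl
  comp_whiskerRight _ _ _ := hom_ext₂ fun _ _ => rfl
  whiskerRight_id η := by
    rw [← Category.assoc, Iso.eq_comp_inv]
    exact hom_ext₂ fun m b => (η.map_ract b m).symm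
  whiskerRight_comp _ _ _ := hom_ext₃' fun _ _ _ => rfl
  whisker_assoc _ _ _ _ _ := hom_ext₃ fun _ _ _ => rfl
  whisker_exchange _ _ := hom_ext₂ fun _ _ => rfl
  pentagon M N P Q := by
    refine hom_ext₃ fun t p q => ?_
    exact lin_ext_apply
      (Intertwiner.lin (tensorHom (assocHom M N P) (𝟙 Q) ≫ assocHom M (tensor N P) Q ≫
        tensorHom (𝟙 M) (assocHom N P Q)) ∘ₗ (tm (tensor (tensor M N) P) Q).flip q ∘ₗ
          (tm (tensor M N) P).flip p)
      (Intertwiner.lin (assocHom (tensor M N) P Q ≫ assocHom M N (tensor P Q)) ∘ₗ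
        (tm (tensor (tensor M N) P) Q).flip q ∘ₗ (tm (tensor M N) P).flip p)
      (fun _ _ => rfl) t
  triangle M N := hom_ext₃ fun m b n => (tm_bal m b n).symm

namespace BiMod

section
variable {A B C : SSAlg.{v} k}

/-- The space `hom_B(M, B)` of right `B`-linear maps from `M` to `B`. -/
def rightHom (M : BiMod A B) : Submodule k (M →ₗ[k] B) where
  carrier := {f | ∀ b m, f (M.ract b m) = f m * b}
  add_mem' hf hg b m := by simp [hf b m, hg b m, add_mul]
  zero_mem' b m := by simp
  smul_mem' c f hf b m := by simp [hf b m]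

theorem rightHom_ract {M : BiMod A B} (f : rightHom M) (b : B) (m : M) :
    f.1 (M.ract b m) = f.1 m * b := f.2 b m

/-- The `(Aᵒᵖ, Bᵒᵖ)`-bimodule `hom_B(M, B)`, with left action `(a f)(m) = f(a m)` of `a : Aᵒᵖ`
and right action `(f b)(m) = b f(m)` of `b : Bᵒᵖ`. -/
def dual (M : BiMod A B) : BiMod A.opp B.opp where
  carrier := rightHom M
  lact := LinearMap.mk₂ k
    (fun a f => ⟨f.1 ∘ₗ M.lact (A.toOpp.symm a), fun b m => by simp [← rightHom_ract]⟩)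
    (fun _ _ _ => by ext; simp) (fun _ _ _ => by ext; simp)
    (fun _ _ _ => by ext; simp) (fun _ _ _ => by ext; simp)
  ract := LinearMap.mk₂ k
    (fun b f => ⟨LinearMap.mulLeft k (B.toOpp.symm b) ∘ₗ f.1, fun b' m => by
      simp [rightHom_ract, mul_assoc]⟩)
    (fun _ _ _ => by ext; simp [add_mul]) (fun _ _ _ => by ext; simp)
    (fun _ _ _ => by ext; simp [mul_add]) (fun _ _ _ => by ext; simp)
  lact_one f := by ext; simp
  lact_mul a a' f := by ext; simp
  ract_one f := by ext; simp
  ract_mul b b' f := by ext; simp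
  ract_lact a b f := by ext; simp

/-- The evaluation `(f, m) ↦ f(m)`. -/
def ev (M : BiMod A B) : dual M →ₗ[k] M →ₗ[k] B := (rightHom M).subtype

/-- A right `B`-linear map as an element of the dual bimodule. -/
def mkDual (M : BiMod A B) (f : M →ₗ[k] B) (h : ∀ b m, f (M.ract b m) = f m * b) : dual M :=
  (⟨f, h⟩ : rightHom M)

@[simp] theorem ev_mkDual (M : BiMod A B) (f : M →ₗ[k] B) (h) (m : M) :
    ev M (mkDual M f h) m = f m := rfl

@[simp] theorem ev_lact (M : BiMod A B) (a : A.opp) (f : dual M) (m : M) :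
    ev M ((dual M).lact a f) m = ev M f (M.lact (A.toOpp.symm a) m) := rfl

@[simp] theorem ev_ract (M : BiMod A B) (b : B.opp) (f : dual M) (m : M) :
    ev M ((dual M).ract b f) m = B.toOpp.symm b * ev M f m := rfl

@[simp] theorem ev_apply_ract (M : BiMod A B) (f : dual M) (b : B) (m : M) :
    ev M f (M.ract b m) = ev M f m * b := rightHom_ract (M := M) f b m

theorem dual_ext {M : BiMod A B} {f g : dual M} (h : ∀ m, ev M f m = ev M g m) : f = g :=
  Subtype.ext (LinearMap.ext h)

/-- The adjoint `f^* : hom_B(N, B) → hom_B(M, B)`, `g ↦ g ∘ f`, of an intertwiner `f : M → N`. -/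
def dualMap {M N : BiMod A B} (f : M ⟶ N) : dual N ⟶ dual M where
  lin :=
    { toFun := fun g => mkDual M (ev N g ∘ₗ f.lin) fun b m => by simp
      map_add' := fun _ _ => dual_ext fun _ => by simp
      map_smul' := fun _ _ => dual_ext fun _ => by simp }
  map_lact _ _ := dual_ext fun _ => by simp
  map_ract _ _ := dual_ext fun _ => by simp

/-- The intertwiner `hom_A(A, A) → Aᵒᵖ`, `f ↦ f(1)`. -/
def dualUnit (A : SSAlg.{v} k) : dual (unit A) ⟶ unit A.opp where
  lin := (ofAlg A.opp).toLinearMap ∘ₗ A.toOpp.toLinearMap ∘ₗ (ev (unit A)).flip (ofAlg A 1)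
  map_lact a f := by
    have h := ev_apply_ract (unit A) f (A.toOpp.symm a) (ofAlg A 1)
    simp only [ract_ofAlg, one_mul] at h
    simp [h]
  map_ract b f := by simp

/-- For `f` in `hom_B(M, B)` and `g` in `hom_C(N, C)`, the linear map `m ⊗ n ↦ g(f(m) n)`. -/
def pairLin (M : BiMod A B) (N : BiMod B C) (f : dual M) (g : dual N) : tensor M N →ₗ[k] C :=
  lift ((N.lact ∘ₗ ev M f).compr₂ (ev N g)) fun m b n => by simp

@[simp] theorem pairLin_tm (M : BiMod A B) (N : BiMod B C) (f : dual M) (g : dual N)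
    (m : M) (n : N) : pairLin M N f g (tm M N m n) = ev N g (N.lact (ev M f m) n) := rfl

/-- The map `m ⊗ n ↦ g(f(m) n)` as an element of `hom_C(M ⊗_B N, C)`. -/
def dualPair (M : BiMod A B) (N : BiMod B C) (f : dual M) (g : dual N) : dual (tensor M N) :=
  mkDual (tensor M N) (pairLin M N f g)
    (fun c t => lin_ext_apply (pairLin M N f g ∘ₗ (tensor M N).ract c)
      (LinearMap.mulRight k c ∘ₗ pairLin M N f g) (fun m n => by simp [← ract_lact]) t)

@[simp] theorem ev_dualPair (M : BiMod A B) (N : BiMod B C) (f : dual M) (g : dual N)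
    (m : M) (n : N) :
    ev (tensor M N) (dualPair M N f g) (tm M N m n) = ev N g (N.lact (ev M f m) n) := rfl

theorem dual_tensor_ext {M : BiMod A B} {N : BiMod B C} {f g : dual (tensor M N)}
    (h : ∀ m n, ev (tensor M N) f (tm M N m n) = ev (tensor M N) g (tm M N m n)) : f = g :=
  dual_ext (lin_ext_apply _ _ h)

/-- The intertwiner `hom_B(M, B) ⊗_{Bᵒᵖ} hom_C(N, C) → hom_C(M ⊗_B N, C)` which sends `f ⊗ g` to
`m ⊗ n ↦ g(f(m) n)`. -/
def dualTensor (M : BiMod A B) (N : BiMod B C) :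
    tensor (dual M) (dual N) ⟶ dual (tensor M N) :=
  desc
    (LinearMap.mk₂ k (dualPair M N)
      (fun _ _ _ => dual_tensor_ext fun _ _ => by simp)
      (fun _ _ _ => dual_tensor_ext fun _ _ => by simp)
      (fun _ _ _ => dual_tensor_ext fun _ _ => by simp)
      (fun _ _ _ => dual_tensor_ext fun _ _ => by simp))
    (fun _ _ _ => dual_tensor_ext fun _ _ => by simp)
    (fun _ _ _ => dual_tensor_ext fun _ _ => by simp)
    (fun _ _ _ => dual_tensor_ext fun _ _ => by simp)

/-- The element `f ↦ f(m)` of `hom_{Bᵒᵖ}(hom_B(M, B), Bᵒᵖ)`. -/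
def evalAt (M : BiMod A B) (m : M) : dual (dual M) :=
  mkDual (dual M) (B.toOpp.toLinearMap ∘ₗ (ev M).flip m) fun b f => by simp

@[simp] theorem ev_evalAt (M : BiMod A B) (m : M) (f : dual M) :
    ev (dual M) (evalAt M m) f = B.toOpp (ev M f m) := rfl

/-- The canonical map `M → hom_{Bᵒᵖ}(hom_B(M, B), Bᵒᵖ)`, `m ↦ (f ↦ f(m))`. -/
def doubleDual (M : BiMod A B) : M →ₗ[k] dual (dual M) where
  toFun := evalAt M
  map_add' _ _ := dual_ext fun _ => by simp
  map_smul' _ _ := dual_ext fun _ => by simp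

@[simp] theorem ev_doubleDual (M : BiMod A B) (m : M) (f : dual M) :
    ev (dual M) (doubleDual M m) f = B.toOpp (ev M f m) := rfl

theorem doubleDual_lact (M : BiMod A B) (a : A) (m : M) : doubleDual M (M.lact a m) =
    (dual (dual M)).lact (A.opp.toOpp (A.toOpp a)) (doubleDual M m) :=
  dual_ext fun _ => by simp

theorem doubleDual_ract (M : BiMod A B) (b : B) (m : M) : doubleDual M (M.ract b m) =
    (dual (dual M)).ract (B.opp.toOpp (B.toOpp b)) (doubleDual M m) :=
  dual_ext fun _ => by simp

/-- The identity bimodule `A`, with its right action regarded as an action of `(Aᵒᵖ)ᵒᵖ`. -/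
def unitOpOp (A : SSAlg.{v} k) : BiMod A A.opp.opp where
  carrier := A
  lact := LinearMap.mul k A
  ract := (LinearMap.mul k A).flip ∘ₗ (A.toOpp.trans A.opp.toOpp).symm.toLinearMap
  lact_one := by simp
  lact_mul := by simp [mul_assoc]
  ract_one := by simp
  ract_mul := by simp [mul_assoc]
  ract_lact := by simp [mul_assoc]

/-- An element of `A` as an element of the bimodule `unitOpOp A`. -/
def ofAlg' (A : SSAlg.{v} k) : A ≃ₗ[k] unitOpOp A := LinearEquiv.refl k A

@[simp] theorem lact_ofAlg' (a x : A) :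
    (unitOpOp A).lact a (ofAlg' A x) = ofAlg' A (a * x) := rfl

@[simp] theorem ract_ofAlg' (a : A.opp.opp) (x : A) : (unitOpOp A).ract a (ofAlg' A x) =
    ofAlg' A (x * A.toOpp.symm (A.opp.toOpp.symm a)) := rfl

@[simp] theorem ofAlg'_symm_lact (a : A) (x : unitOpOp A) :
    (ofAlg' A).symm ((unitOpOp A).lact a x) = a * (ofAlg' A).symm x := rfl

@[simp] theorem ofAlg'_symm_ract (a : A.opp.opp) (x : unitOpOp A) :
    (ofAlg' A).symm ((unitOpOp A).ract a x) =
      (ofAlg' A).symm x * A.toOpp.symm (A.opp.toOpp.symm a) := rfl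

/-- The intertwiner `M ⊗_B B → A ⊗_A hom_{Bᵒᵖ}(hom_B(M, B), Bᵒᵖ)`, the composite of the right
unitor of `M`, the canonical map to the double dual and the inverse of the left unitor:
`m ⊗ b ↦ 1 ⊗ (f ↦ f(m b))`. -/
def unitNat (M : BiMod A B) :
    tensor M (unitOpOp B) ⟶ tensor (unitOpOp A) (dual (dual M)) :=
  desc
    (LinearMap.mk₂ k
      (fun m b => tm (unitOpOp A) (dual (dual M)) (ofAlg' A 1)
        (doubleDual M (M.ract ((ofAlg' B).symm b) m)))
      (fun _ _ _ => by simp) (fun _ _ _ => by simp) (fun _ _ _ => by simp) (fun _ _ _ => by simp))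
    (fun m b n => by simp)
    (fun a m n => by simp [doubleDual_lact, ← tm_bal])
    (fun c m n => by simp [doubleDual_ract])

/-- For `x : Aᵒᵖ`, the element `a ↦ x a` of `hom_A(A, A)`. -/
def mulBy (A : SSAlg.{v} k) (x : A.opp) : dual (unitOpOp A) :=
  mkDual (unitOpOp A)
    (A.opp.toOpp.toLinearMap ∘ₗ A.toOpp.toLinearMap ∘ₗ LinearMap.mulLeft k (A.toOpp.symm x) ∘ₗ
      (ofAlg' A).symm.toLinearMap)
    (fun b m => by simp [← mul_assoc])

@[simp] theorem ev_mulBy (A : SSAlg.{v} k) (x : A.opp) (m : unitOpOp A) :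
    ev (unitOpOp A) (mulBy A x) m = A.opp.toOpp (A.toOpp (A.toOpp.symm x * (ofAlg' A).symm m)) :=
  rfl

/-- The intertwiner `Aᵒᵖ → hom_A(A, A)`, `x ↦ (a ↦ x a)`, inverse to `f ↦ f(1)`. -/
def zetaHom (A : SSAlg.{v} k) : unitOpOp A.opp ⟶ dual (unitOpOp A) where
  lin :=
    { toFun := fun x => mulBy A ((ofAlg' A.opp).symm x)
      map_add' := fun _ _ => dual_ext fun _ => by simp [add_mul]
      map_smul' := fun _ _ => dual_ext fun _ => by simp }
  map_lact a x := dual_ext fun m => by simp [mul_assoc]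
  map_ract b x := dual_ext fun m => by simp [mul_assoc]

end
end BiMod

/-- The data of the canonical duality on the Morita bicategory: `A° = Aᵒᵖ`,
`M° = hom_B(M, B)` for an `(A, B)`-bimodule `M`, and `f° = f^*`, with the constraints
`hom_A(A, A) → Aᵒᵖ`, `f ↦ f(1)` and `M° ⊗ N° → (M ⊗ N)°`, `f ⊗ g ↦ (m ⊗ n ↦ g(f(m) n))`;
`y_A` is the identity bimodule, `y_M` is induced by the canonical map from `M` to its double
dual, and `ζ_A` is inverse to `f ↦ f(1)`. -/
def circData (k : Type u) [Field k] : DualityInvolution.DualityData (SSAlg.{v} k) where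
  obj A := A.opp
  map M := dual M
  map₂ f := dualMap f
  mapId A := dualUnit A
  mapComp M N := dualTensor M N
  y A := unitOpOp A
  yNat M := unitNat M
  zeta A := zetaHom A

end MoritaTwo

/-! Everything rests on dual bases. A finite-dimensional right module `M` over a semisimple `B` is
projective, so there are `e_i` in `M` and `φ_i` in `M°` with `m = Σ e_i φ_i(m)`
(`exists_dualBasis`), and dually `f = Σ φ_i · f(e_i)` in `M°` (`dualBasis_expand`). These two
expansions give the two isomorphisms that are not formal: `ψ_M : M → M°°` (`doubleDual_bijective`)
and `M° ⊗ N° → (M ⊗ N)°` (`dualTensor_bijective`).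

After that, every axiom is an equality of two intertwiners, and it can be checked on generators. The
laws of the pseudofunctor are stated for `dualTensor`, not for its inverse, and become identities
between values such as `h(g(f(m) n) p)`. For maps out of `M°°` it suffices to test on elements
`ψ(m)`, since `ψ` is surjective; there all the 2-morphisms have explicit formulas. That `y` respects
composition comes down to `ψ` being monoidal (`doubleDualTensor_doubleDual`).

The transformation `y` has an inverse whose components are the same algebras `A`, now viewed as
`(A°°, A)`-bimodules. The multiplication isomorphisms `A ⊗ A ≅ A` make the two transformations
mutually inverse, and an equivalence can always be promoted to an adjoint one without changing `y`.
The modification law for `ζ` amounts to both sides having the value `x f(am)`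
(`zetaHom_dualTensor`), and the coherence law to associativity, `(xa)b = x(ab)`
(`zetaHom_coherence`). -/

namespace MoritaTwo

open CategoryTheory Bicategory TensorProduct DualityInvolution
open scoped Pseudofunctor.StrongTrans

namespace BiMod

variable {k : Type u} [Field k] {A B C D : SSAlg.{v} k}

/-! ### Dual bases, and the invertibility of `ψ` and of the composition constraint. -/

/-- The right module underlying an `(A, B)`-bimodule, as a module over `Bᵐᵒᵖ`. -/
abbrev rightModule (M : BiMod A B) : Module (B : Type v)ᵐᵒᵖ M where
  smul b m := M.ract b.unop m
  one_smul m := M.ract_one m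
  mul_smul b b' m := M.ract_mul b'.unop b.unop m
  smul_zero b := (M.ract b.unop).map_zero
  smul_add b := (M.ract b.unop).map_add
  add_smul b b' m := LinearMap.congr_fun (M.ract.map_add b.unop b'.unop) m
  zero_smul m := LinearMap.congr_fun M.ract.map_zero m

theorem ract_algebraMap (M : BiMod A B) (c : k) (m : M) :
    M.ract (algebraMap k B c) m = c • m := by
  rw [Algebra.algebraMap_eq_smul_one]
  simp

/-- Over a semisimple algebra, a finite-dimensional right module has a dual basis. -/
theorem exists_dualBasis (M : BiMod A B) :
    ∃ (n : ℕ) (e : Fin n → M) (φ : Fin n → dual M),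
      ∀ m, ∑ i, M.ract (ev M (φ i) m) (e i) = m := by
  let _ := rightModule M
  -- A family spanning over `k` also generates over `Bᵐᵒᵖ`, because `k` acts through `algebraMap k
  -- B`.
  obtain ⟨n, e, he⟩ := Module.Finite.exists_fin (R := k) (M := M)
  let π := Fintype.linearCombination (B : Type v)ᵐᵒᵖ e
  have hπ : Function.Surjective π := by
    intro m
    have hm : m ∈ Submodule.span k (Set.range e) := he ▸ Submodule.mem_top
    obtain ⟨c, rfl⟩ := (Submodule.mem_span_range_iff_exists_fun k).1 hm
    refine ⟨fun i => MulOpposite.op (algebraMap k B (c i)), ?_⟩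
    rw [Fintype.linearCombination_apply]
    exact Finset.sum_congr rfl fun i _ => ract_algebraMap M (c i) (e i)
  -- This is where semisimplicity enters: `Bᵐᵒᵖ` is again semisimple, so the free cover `π` splits.
  -- The `φ i` are the coordinates of the splitting `s`.
  have : Module.Projective (B : Type v)ᵐᵒᵖ M := Module.projective_of_isSemisimpleRing _ _
  obtain ⟨s, hs⟩ := Module.projective_lifting_property π LinearMap.id hπ
  refine ⟨n, e, fun i => mkDual M
    { toFun := fun m => (s m i).unop
      map_add' := fun _ _ => by simp
      map_smul' := fun c m => by
        -- Linearity over `k` is linearity over `Bᵐᵒᵖ` for the central elements `algebraMap k B c`.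
        have h := congrFun (s.map_smul (MulOpposite.op (algebraMap k B c)) m) i
        have h' : MulOpposite.op (algebraMap k B c) • m = c • m := ract_algebraMap M c m
        rw [h'] at h
        rw [h]
        simp [Algebra.smul_def, Algebra.commutes] }
    fun b m => ?_, fun m => LinearMap.congr_fun hs m⟩
  have h := congrFun (s.map_smul (MulOpposite.op b) m) i
  exact congrArg MulOpposite.unop h

/-- Applying `f` to `m = Σ e_i φ_i(m)` gives `f(m) = Σ f(e_i) φ_i(m)`, and left multiplication of
values by `f(e_i)` is the right action of `Bᵒᵖ` on `M°`. -/
theorem dualBasis_expand (M : BiMod A B) {n : ℕ} {e : Fin n → M} {φ : Fin n → dual M}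
    (h : ∀ m, ∑ i, M.ract (ev M (φ i) m) (e i) = m) (f : dual M) :
    ∑ i, (dual M).ract (B.toOpp (ev M f (e i))) (φ i) = f :=
  dual_ext fun m => by
    conv_rhs => rw [← h m]
    simp

/-- A bijective intertwiner is an isomorphism. -/
noncomputable def isoOfBijective {M N : BiMod A B} (f : M ⟶ N)
    (hf : Function.Bijective f.lin) : M ≅ N where
  hom := f
  inv :=
    { lin := (LinearEquiv.ofBijective f.lin hf).symm.toLinearMap
      map_lact := fun a n => (LinearEquiv.ofBijective f.lin hf).injective (by
        simp [LinearEquiv.ofBijective_apply])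
      map_ract := fun a n => (LinearEquiv.ofBijective f.lin hf).injective (by
        simp [LinearEquiv.ofBijective_apply]) }
  hom_inv_id := hom_ext (LinearMap.ext fun m =>
    (LinearEquiv.ofBijective f.lin hf).symm_apply_apply m)
  inv_hom_id := hom_ext (LinearMap.ext fun m =>
    (LinearEquiv.ofBijective f.lin hf).apply_symm_apply m)

/-- If every `φ_i` vanishes at `m`, the expansion of `m` is zero. For surjectivity, applying `F` to
the expansion of `f` gives `F(f) = Σ f(e_i) F(φ_i)`, which is the value of `f` at `Σ e_i F(φ_i)`. -/
theorem doubleDual_bijective (M : BiMod A B) : Function.Bijective (doubleDual M) := by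
  obtain ⟨n, e, φ, h⟩ := exists_dualBasis M
  refine ⟨(injective_iff_map_eq_zero _).2 fun m hm => ?_, fun F => ?_⟩
  · have hφ : ∀ f, ev M f m = 0 := fun f =>
      B.toOpp.injective (by rw [← ev_doubleDual, hm]; simp)
    rw [← h m]
    simp [hφ]
  · refine ⟨∑ i, M.ract (B.toOpp.symm (ev (dual M) F (φ i))) (e i), dual_ext fun f => ?_⟩
    conv_rhs => rw [← dualBasis_expand M h f]
    rw [ev_doubleDual, map_sum, map_sum, map_sum]
    simp

/-- The canonical isomorphism from a bimodule to its double dual, as a linear equivalence. -/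
noncomputable def doubleDualEquiv (M : BiMod A B) : M ≃ₗ[k] dual (dual M) :=
  LinearEquiv.ofBijective (doubleDual M) (doubleDual_bijective M)

@[simp] theorem doubleDualEquiv_symm_doubleDual (M : BiMod A B) (m : M) :
    (doubleDualEquiv M).symm (doubleDual M m) = m :=
  (doubleDualEquiv M).symm_apply_apply m

/-- The map `g ↦ (n ↦ h(m ⊗ n))`. -/
def partialDual (M : BiMod A B) (N : BiMod B C) (h : dual (tensor M N)) (m : M) : dual N :=
  mkDual N (ev (tensor M N) h ∘ₗ tm M N m) fun c n => by
    simp [← ract_tm]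

/-- The inverse is `t ↦ Σ φ_i ⊗ t(e_i ⊗ -)`, so only a dual basis of `M` is needed. In one direction
the scalars `f(e_i)` move across the tensor sign and reassemble `f`; in the other, the `φ_i(m)` move
back and reassemble `m`. -/
theorem dualTensor_bijective (M : BiMod A B) (N : BiMod B C) :
    Function.Bijective (dualTensor M N).lin := by
  obtain ⟨r, e, φ, h⟩ := exists_dualBasis M
  have hp : ∀ f g m, partialDual M N ((dualTensor M N).lin (tm _ _ f g)) m =
      (dual N).lact (B.toOpp (ev M f m)) g := fun f g m => dual_ext fun n => rfl
  let σ : dual (tensor M N) →ₗ[k] tensor (dual M) (dual N) :=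
    { toFun := fun t => ∑ i, tm (dual M) (dual N) (φ i) (partialDual M N t (e i))
      map_add' := fun t t' => by
        rw [← Finset.sum_add_distrib]
        refine Finset.sum_congr rfl fun i _ => ?_
        rw [← map_add]
        rfl
      map_smul' := fun c t => by
        rw [Finset.smul_sum]
        refine Finset.sum_congr rfl fun i _ => ?_
        rw [← map_smul]
        rfl }
  have h1 : ∀ t, σ ((dualTensor M N).lin t) = t := fun t =>
    lin_ext_apply (σ ∘ₗ (dualTensor M N).lin) LinearMap.id (fun f g => by
      change ∑ i, tm (dual M) (dual N) (φ i) (partialDual M N _ (e i)) = _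
      simp only [hp, ← tm_bal]
      rw [← LinearMap.sum_apply, ← map_sum, dualBasis_expand M h f]
      rfl) t
  refine ⟨Function.LeftInverse.injective h1, fun t => ⟨σ t, dual_tensor_ext fun m n => ?_⟩⟩
  change ev (tensor M N) ((dualTensor M N).lin
    (∑ i, tm (dual M) (dual N) (φ i) (partialDual M N t (e i)))) _ = _
  conv_rhs => rw [← h m]
  rw [map_sum, map_sum, map_sum, LinearMap.sum_apply, LinearMap.sum_apply, map_sum]
  refine Finset.sum_congr rfl fun i _ => ?_
  rw [tm_bal]
  rfl

/-- The isomorphism `hom_B(M, B) ⊗ hom_C(N, C) ≅ hom_C(M ⊗_B N, C)`. -/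
noncomputable def dualTensorIso (M : BiMod A B) (N : BiMod B C) :
    tensor (dual M) (dual N) ≅ dual (tensor M N) :=
  isoOfBijective (dualTensor M N) (dualTensor_bijective M N)

/-- The isomorphism `hom_A(A, A) ≅ Aᵒᵖ`. -/
def dualUnitIso (A : SSAlg.{v} k) : dual (unit A) ≅ unit A.opp where
  hom := dualUnit A
  inv :=
    { lin :=
        { toFun := fun x => mkDual (unit A)
            (LinearMap.mulLeft k (A.toOpp.symm ((ofAlg A.opp).symm x)) ∘ₗ
              (ofAlg A).symm.toLinearMap) fun _ _ => (mul_assoc _ _ _).symm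
          map_add' := fun _ _ => dual_ext fun _ => add_mul (R := A) _ _ _
          map_smul' := fun _ _ => dual_ext fun _ => smul_mul_assoc (β := A) _ _ _ }
      map_lact := fun _ _ => dual_ext fun _ => mul_assoc _ _ _
      map_ract := fun _ _ => dual_ext fun _ => mul_assoc _ _ _ }
  hom_inv_id := hom_ext (LinearMap.ext fun f => dual_ext fun m =>
    (ev_apply_ract (unit A) f ((ofAlg A).symm m) (ofAlg A 1)).symm.trans
      (congrArg (ev (unit A) f) (one_mul (M := A) m)))
  inv_hom_id := hom_ext (LinearMap.ext fun x =>
    congrArg (fun a => ofAlg A.opp (A.toOpp a))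
      (mul_one (A.toOpp.symm ((ofAlg A.opp).symm x))))

/-! ### Naturality cells of `y` and of its inverse, and the isomorphism `ζ`. -/

/-- Intertwiners out of `M°° ⊗ N` agree if they agree on the elements `ψ(m) ⊗ n`. -/
theorem hom_ext_doubleDual_left {M : BiMod A B} {N : BiMod B.opp.opp C} {P : BiMod A.opp.opp C}
    {f g : tensor (dual (dual M)) N ⟶ P}
    (h : ∀ m n, f.lin (tm _ N (doubleDual M m) n) = g.lin (tm _ N (doubleDual M m) n)) :
    f = g :=
  hom_ext₂ fun F n => by
    obtain ⟨m, rfl⟩ := (doubleDual_bijective M).2 F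
    exact h m n

/-- Intertwiners out of `N ⊗ M°°` agree if they agree on the elements `n ⊗ ψ(m)`. -/
theorem hom_ext_doubleDual_right {M : BiMod A B} {N : BiMod C A.opp.opp} {P : BiMod C B.opp.opp}
    {f g : tensor N (dual (dual M)) ⟶ P}
    (h : ∀ n m, f.lin (tm N _ n (doubleDual M m)) = g.lin (tm N _ n (doubleDual M m))) :
    f = g :=
  hom_ext₂ fun n F => by
    obtain ⟨m, rfl⟩ := (doubleDual_bijective M).2 F
    exact h n m

theorem doubleDualEquiv_symm_lact (M : BiMod A B) (a : A.opp.opp) (F : dual (dual M)) :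
    (doubleDualEquiv M).symm ((dual (dual M)).lact a F) =
      M.lact (A.toOpp.symm (A.opp.toOpp.symm a)) ((doubleDualEquiv M).symm F) := by
  obtain ⟨m, rfl⟩ := (doubleDual_bijective M).2 F
  have := doubleDual_lact M (A.toOpp.symm (A.opp.toOpp.symm a)) m
  simp only [LinearEquiv.apply_symm_apply] at this
  rw [← this]
  simp

theorem doubleDualEquiv_symm_ract (M : BiMod A B) (b : B.opp.opp) (F : dual (dual M)) :
    (doubleDualEquiv M).symm ((dual (dual M)).ract b F) =
      M.ract (B.toOpp.symm (B.opp.toOpp.symm b)) ((doubleDualEquiv M).symm F) := by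
  obtain ⟨m, rfl⟩ := (doubleDual_bijective M).2 F
  have := doubleDual_ract M (B.toOpp.symm (B.opp.toOpp.symm b)) m
  simp only [LinearEquiv.apply_symm_apply] at this
  rw [← this]
  simp

/-- The isomorphism `M ⊗_B B ≅ A ⊗_A M°°`. -/
noncomputable def unitNatIso (M : BiMod A B) :
    tensor M (unitOpOp B) ≅ tensor (unitOpOp A) (dual (dual M)) where
  hom := unitNat M
  inv := desc
    (LinearMap.mk₂ k
      (fun a F => tm M (unitOpOp B)
        (M.lact ((ofAlg' A).symm a) ((doubleDualEquiv M).symm F)) (ofAlg' B 1))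
      (fun _ _ _ => by simp) (fun _ _ _ => by simp) (fun _ _ _ => by simp) (fun _ _ _ => by simp))
    (fun a b F => by simp [doubleDualEquiv_symm_lact])
    (fun a m n => by simp)
    (fun c m n => by
      simp only [LinearMap.mk₂_apply, doubleDualEquiv_symm_ract, ← ract_lact, tm_bal]
      simp)
  hom_inv_id := hom_ext₂ fun m b => by
    change tm M (unitOpOp B) (M.lact 1 ((doubleDualEquiv M).symm (doubleDual M
      (M.ract ((ofAlg' B).symm b) m)))) (ofAlg' B 1) = tm M (unitOpOp B) m b
    rw [doubleDualEquiv_symm_doubleDual, lact_one, tm_bal, lact_ofAlg', mul_one]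
    rfl
  inv_hom_id := hom_ext_doubleDual_right fun a m => by
    change tm (unitOpOp A) (dual (dual M)) (ofAlg' A 1) (doubleDual M (M.ract 1
      (M.lact ((ofAlg' A).symm a) ((doubleDualEquiv M).symm (doubleDual M m))))) =
        tm (unitOpOp A) (dual (dual M)) a (doubleDual M m)
    rw [doubleDualEquiv_symm_doubleDual, ract_one, doubleDual_lact, ← tm_bal]
    simp

/-- The identity bimodule `A`, with its left action regarded as an action of `(Aᵒᵖ)ᵒᵖ`. -/
def opOpUnit (A : SSAlg.{v} k) : BiMod A.opp.opp A where
  carrier := A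
  lact := LinearMap.mul k A ∘ₗ (A.toOpp.trans A.opp.toOpp).symm.toLinearMap
  ract := (LinearMap.mul k A).flip
  lact_one := by simp
  lact_mul := by simp [mul_assoc]
  ract_one := by simp
  ract_mul := by simp [mul_assoc]
  ract_lact := by simp [mul_assoc]

/-- An element of `A` as an element of the bimodule `opOpUnit A`. -/
def ofAlgOpOp (A : SSAlg.{v} k) : A ≃ₗ[k] opOpUnit A := LinearEquiv.refl k A

@[simp] theorem lact_ofAlgOpOp (a : A.opp.opp) (x : A) :
    (opOpUnit A).lact a (ofAlgOpOp A x) =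
      ofAlgOpOp A (A.toOpp.symm (A.opp.toOpp.symm a) * x) := rfl

@[simp] theorem ract_ofAlgOpOp (a x : A) :
    (opOpUnit A).ract a (ofAlgOpOp A x) = ofAlgOpOp A (x * a) := rfl

@[simp] theorem ofAlgOpOp_symm_lact (a : A.opp.opp) (x : opOpUnit A) :
    (ofAlgOpOp A).symm ((opOpUnit A).lact a x) =
      A.toOpp.symm (A.opp.toOpp.symm a) * (ofAlgOpOp A).symm x := rfl

@[simp] theorem ofAlgOpOp_symm_ract (a : A) (x : opOpUnit A) :
    (ofAlgOpOp A).symm ((opOpUnit A).ract a x) = (ofAlgOpOp A).symm x * a := rfl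

/-- The isomorphism `M°° ⊗_B B ≅ A ⊗_A M`. -/
noncomputable def counitNatIso (M : BiMod A B) :
    tensor (dual (dual M)) (opOpUnit B) ≅ tensor (opOpUnit A) M where
  hom := desc
    (LinearMap.mk₂ k
      (fun F b => tm (opOpUnit A) M (ofAlgOpOp A 1)
        (M.ract ((ofAlgOpOp B).symm b) ((doubleDualEquiv M).symm F)))
      (fun _ _ _ => by simp) (fun _ _ _ => by simp) (fun _ _ _ => by simp) (fun _ _ _ => by simp))
    (fun F b c => by simp [doubleDualEquiv_symm_ract])
    (fun a F b => by simp [doubleDualEquiv_symm_lact, ← tm_bal])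
    (fun c F b => by simp)
  inv := desc
    (LinearMap.mk₂ k
      (fun a m => tm (dual (dual M)) (opOpUnit B)
        (doubleDual M (M.lact ((ofAlgOpOp A).symm a) m)) (ofAlgOpOp B 1))
      (fun _ _ _ => by simp) (fun _ _ _ => by simp) (fun _ _ _ => by simp) (fun _ _ _ => by simp))
    (fun a b m => by simp)
    (fun a b m => by simp [doubleDual_lact])
    (fun c a m => by
      simp only [LinearMap.mk₂_apply, ← ract_lact, doubleDual_ract, tm_bal]
      simp)
  hom_inv_id := hom_ext_doubleDual_left fun m b => by
    change tm (dual (dual M)) (opOpUnit B) (doubleDual M (M.lact 1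
      (M.ract ((ofAlgOpOp B).symm b) ((doubleDualEquiv M).symm (doubleDual M m)))))
        (ofAlgOpOp B 1) = tm (dual (dual M)) (opOpUnit B) (doubleDual M m) b
    rw [doubleDualEquiv_symm_doubleDual, lact_one, doubleDual_ract, tm_bal]
    simp
  inv_hom_id := hom_ext₂ fun a m => by
    change tm (opOpUnit A) M (ofAlgOpOp A 1) (M.ract 1 ((doubleDualEquiv M).symm
      (doubleDual M (M.lact ((ofAlgOpOp A).symm a) m)))) = tm (opOpUnit A) M a m
    rw [doubleDualEquiv_symm_doubleDual, ract_one, ← tm_bal]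
    simp

/-- The cell is defined through `ψ⁻¹`, which is obtained from bijectivity and does not reduce by
computation. Later calculations therefore go through this value on `ψ(m) ⊗ b`. -/
theorem counitNatIso_hom_doubleDual (M : BiMod A B) (m : M) (b : opOpUnit B) :
    (counitNatIso M).hom.lin (tm (dual (dual M)) (opOpUnit B) (doubleDual M m) b) =
      tm (opOpUnit A) M (ofAlgOpOp A 1) (M.ract ((ofAlgOpOp B).symm b) m) := by
  change tm (opOpUnit A) M (ofAlgOpOp A 1) (M.ract ((ofAlgOpOp B).symm b)
    ((doubleDualEquiv M).symm (doubleDual M m))) = _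
  rw [doubleDualEquiv_symm_doubleDual]

/-- The isomorphism `Aᵒᵖ ≅ hom_A(A, A)`, inverse to the evaluation at `1`. -/
def zetaIso (A : SSAlg.{v} k) : unitOpOp A.opp ≅ dual (unitOpOp A) where
  hom := zetaHom A
  inv :=
    { lin := (ofAlg' A.opp).toLinearMap ∘ₗ A.opp.toOpp.symm.toLinearMap ∘ₗ
        (ev (unitOpOp A)).flip (ofAlg' A 1)
      map_lact := fun a f => by
        have h := ev_apply_ract (unitOpOp A) f (A.opp.toOpp (A.toOpp (A.toOpp.symm a))) (ofAlg' A 1)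
        simp only [ract_ofAlg', one_mul, LinearEquiv.symm_apply_apply] at h
        simp [h]
      map_ract := fun b f => by simp }
  hom_inv_id := hom_ext (LinearMap.ext fun x =>
    congrArg (fun a => ofAlg' A.opp (A.toOpp a))
      (mul_one (A.toOpp.symm ((ofAlg' A.opp).symm x))))
  inv_hom_id := hom_ext (LinearMap.ext fun f => dual_ext fun m =>
    (ev_apply_ract (unitOpOp A) f (A.opp.toOpp (A.toOpp ((ofAlg' A).symm m))) (ofAlg' A 1)).symm.trans
      (congrArg (ev (unitOpOp A) f) (one_mul (M := A) m)))

/-- `e ⊗ e'` for isomorphisms `e` and `e'`. -/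
def tensorIso {M M' : BiMod A B} {N N' : BiMod B C} (e : M ≅ M') (e' : N ≅ N') :
    tensor M N ≅ tensor M' N' where
  hom := tensorHom e.hom e'.hom
  inv := tensorHom e.inv e'.inv
  hom_inv_id := hom_ext₂ fun m n => congrArg₂ (fun x y => tm M N x y)
    (congrArg (fun f => Intertwiner.lin f m) e.hom_inv_id)
    (congrArg (fun f => Intertwiner.lin f n) e'.hom_inv_id)
  inv_hom_id := hom_ext₂ fun m n => congrArg₂ (fun x y => tm M' N' x y)
    (congrArg (fun f => Intertwiner.lin f m) e.inv_hom_id)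
    (congrArg (fun f => Intertwiner.lin f n) e'.inv_hom_id)

/-! ### Laws of the pseudofunctor, in terms of the explicit map `dualTensor`. -/

theorem dualTensor_whiskerLeft (M : BiMod A B) {N N' : BiMod B C} (η : N' ⟶ N) :
    dualTensor M N ≫ dualMap (tensorHom (𝟙 M) η) =
      tensorHom (𝟙 (dual M)) (dualMap η) ≫ dualTensor M N' :=
  hom_ext₂ fun f g => dual_tensor_ext fun m n =>
    congrArg (ev N g) (η.map_lact (ev M f m) n).symm

theorem dualTensor_whiskerRight {M M' : BiMod A B} (η : M' ⟶ M) (N : BiMod B C) :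
    dualTensor M N ≫ dualMap (tensorHom η (𝟙 N)) =
      tensorHom (dualMap η) (𝟙 (dual N)) ≫ dualTensor M' N :=
  hom_ext₂ fun _ _ => dual_tensor_ext fun _ _ => rfl

/-- Both sides send `(f ⊗ g) ⊗ h` to the functional `m ⊗ (n ⊗ p) ↦ h(g(f(m) n) p)`. -/
theorem dualTensor_assoc (M : BiMod A B) (N : BiMod B C) (P : BiMod C D) :
    tensorHom (dualTensor M N) (𝟙 (dual P)) ≫ dualTensor (tensor M N) P ≫
        dualMap (assocInv M N P) =
      assocHom (dual M) (dual N) (dual P) ≫ tensorHom (𝟙 (dual M)) (dualTensor N P) ≫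
        dualTensor M (tensor N P) :=
  hom_ext₃ fun f g h => dual_ext fun t =>
    lin_ext_apply (ev (tensor M (tensor N P)) _) (ev (tensor M (tensor N P)) _)
      (fun m t => lin_ext_apply
        (ev (tensor M (tensor N P)) ((tensorHom (dualTensor M N) (𝟙 (dual P)) ≫
          dualTensor (tensor M N) P ≫ dualMap (assocInv M N P)).lin
            (tm _ (dual P) (tm (dual M) (dual N) f g) h)) ∘ₗ tm M (tensor N P) m)
        (ev (tensor M (tensor N P)) ((assocHom (dual M) (dual N) (dual P) ≫
          tensorHom (𝟙 (dual M)) (dualTensor N P) ≫ dualTensor M (tensor N P)).lin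
            (tm _ (dual P) (tm (dual M) (dual N) f g) h)) ∘ₗ tm M (tensor N P) m)
        (fun _ _ => rfl) t) t

theorem dualTensor_lunit (M : BiMod A B) :
    dualTensor (unit A) M ≫ dualMap (lunit M).inv =
      tensorHom (dualUnit A) (𝟙 (dual M)) ≫ (lunit (dual M)).hom :=
  hom_ext₂ fun _ _ => dual_ext fun _ => rfl

/-- Unlike the left unit law, this is not definitional: it needs the right linearity of `g`, in the
form `g(f(m)) = g(1) f(m)`. -/
theorem dualTensor_runit (M : BiMod A B) :
    dualTensor M (unit B) ≫ dualMap (runit M).inv =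
      tensorHom (𝟙 (dual M)) (dualUnit B) ≫ (runit (dual M)).hom :=
  hom_ext₂ fun f g => dual_ext fun m => by
    have h := ev_apply_ract (unit B) g (ev M f m) (ofAlg B 1)
    rw [ract_ofAlg, one_mul] at h
    exact (congrArg (fun b => ev (unit B) g (ofAlg B b)) (mul_one (ev M f m))).trans h

/-! ### Pseudonaturality of `y` and of its inverse. -/

theorem unitNat_naturality {M N : BiMod A B} (η : M ⟶ N) :
    tensorHom η (𝟙 (unitOpOp B)) ≫ unitNat N =
      unitNat M ≫ tensorHom (𝟙 (unitOpOp A)) (dualMap (dualMap η)) :=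
  hom_ext₂ fun m b => congrArg (fun x => tm (unitOpOp A) (dual (dual N)) (ofAlg' A 1)
    (doubleDual N x)) (η.map_ract ((ofAlg' B).symm b) m).symm

/-- The second tensor factor on the left is the unit constraint of `(-)°°`. The two sides send `a ⊗
b` to `1 ⊗ ab` and `ab ⊗ 1`, which agree because the tensor product is balanced. -/
theorem unitNat_id (A : SSAlg.{v} k) :
    unitNat (unit A) ≫ tensorHom (𝟙 (unitOpOp A)) (dualMap (dualUnitIso A).inv ≫ dualUnit A.opp) =
      (lunit (unitOpOp A)).hom ≫ (runit (unitOpOp A)).inv :=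
  hom_ext₂ fun a b => by
    have h := tm_bal (M := unitOpOp A) (N := unit A.opp.opp) (ofAlg' A 1)
      (A.opp.toOpp (A.toOpp ((ofAlg A).symm a * (ofAlg' A).symm b))) (ofAlg A.opp.opp 1)
    rw [lact_ofAlg, mul_one, ract_ofAlg', one_mul] at h
    refine Eq.trans ?_ h.symm
    exact congrArg (fun x => tm (unitOpOp A) (unit A.opp.opp) (ofAlg' A 1)
      (ofAlg A.opp.opp (A.opp.toOpp (A.toOpp x)))) (one_mul _)

/-- The intertwiner `(M ⊗ N)°° → M°° ⊗ N°°`, `ψ(m ⊗ n) ↦ ψ(m) ⊗ ψ(n)`. -/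
noncomputable def doubleDualTensor (M : BiMod A B) (N : BiMod B C) :
    dual (dual (tensor M N)) ⟶ tensor (dual (dual M)) (dual (dual N)) :=
  dualMap (dualTensor M N) ≫ (dualTensorIso (dual M) (dual N)).inv

/-- This is the compatibility of `ψ` with composition. Applying the injective `dualTensor` cancels
the inverse in the definition, and then both sides evaluate at `f ⊗ g` to `g(f(m) n)`. -/
theorem doubleDualTensor_doubleDual (M : BiMod A B) (N : BiMod B C) (m : M) (n : N) :
    (doubleDualTensor M N).lin (doubleDual _ (tm M N m n)) =
      tm (dual (dual M)) (dual (dual N)) (doubleDual M m) (doubleDual N n) := by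
  apply (dualTensor_bijective (dual M) (dual N)).1
  refine (congrArg (fun f => Intertwiner.lin f (doubleDual (tensor M N) (tm M N m n)))
    (show doubleDualTensor M N ≫ dualTensor (dual M) (dual N) = dualMap (dualTensor M N) from
      (Category.assoc _ _ _).trans ((congrArg (dualMap (dualTensor M N) ≫ ·)
        (dualTensorIso (dual M) (dual N)).inv_hom_id).trans (Category.comp_id _)))).trans ?_
  exact dual_tensor_ext fun f g => rfl

theorem unitNat_comp (M : BiMod A B) (N : BiMod B C) :
    unitNat (tensor M N) ≫ tensorHom (𝟙 (unitOpOp A)) (doubleDualTensor M N) =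
      (assocHom M N (unitOpOp C)) ≫ tensorHom (𝟙 M) (unitNat N) ≫
        assocInv M (unitOpOp B) (dual (dual N)) ≫ tensorHom (unitNat M) (𝟙 (dual (dual N))) ≫
          assocHom (unitOpOp A) (dual (dual M)) (dual (dual N)) :=
  hom_ext₃ fun m n c => by
    change tm _ (tensor _ _) (ofAlg' A 1) ((doubleDualTensor M N).lin (doubleDual _
      (tm M N m (N.ract ((ofAlg' C).symm c) n)))) =
        tm _ (tensor _ _) (ofAlg' A 1) (tm _ _ (doubleDual M (M.ract 1 m))
          (doubleDual N (N.ract ((ofAlg' C).symm c) n)))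
    rw [doubleDualTensor_doubleDual, ract_one]

theorem counitNat_naturality {M N : BiMod A B} (η : M ⟶ N) :
    tensorHom (dualMap (dualMap η)) (𝟙 (opOpUnit B)) ≫ (counitNatIso N).hom =
      (counitNatIso M).hom ≫ tensorHom (𝟙 (opOpUnit A)) η :=
  hom_ext_doubleDual_left fun m b =>
    (counitNatIso_hom_doubleDual N (η.lin m) b).trans
      ((congrArg (tm (opOpUnit A) N (ofAlgOpOp A 1)) (η.map_ract _ _).symm).trans
        (congrArg (tensorHom (𝟙 (opOpUnit A)) η).lin (counitNatIso_hom_doubleDual M m b)).symm)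

theorem counitNat_id (A : SSAlg.{v} k) :
    (counitNatIso (unit A)).hom =
    tensorHom (dualMap (dualUnitIso A).inv ≫ dualUnit A.opp) (𝟙 (opOpUnit A)) ≫
      (lunit (opOpUnit A)).hom ≫ (runit (opOpUnit A)).inv :=
  hom_ext_doubleDual_left fun a b => by
    refine (counitNatIso_hom_doubleDual (unit A) a b).trans ?_
    have h := tm_bal (M := opOpUnit A) (N := unit A) (ofAlgOpOp A 1)
      ((ofAlg A).symm a * (ofAlgOpOp A).symm b) (ofAlg A 1)
    rw [lact_ofAlg, mul_one, ract_ofAlgOpOp, one_mul] at h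
    exact h.symm.trans (congrArg (fun x => tm (opOpUnit A) (unit A)
      (ofAlgOpOp A (x * (ofAlgOpOp A).symm b)) (ofAlg A 1)) (one_mul _).symm)

/-- It is enough to test on `ψ(m ⊗ n) ⊗ c`. There the inverse constraint splits into `ψ(m) ⊗ ψ(n)`,
and both sides become `1 ⊗ (m ⊗ nc)`. -/
theorem counitNat_comp (M : BiMod A B) (N : BiMod B C) :
    (counitNatIso (tensor M N)).hom =
      tensorHom (doubleDualTensor M N) (𝟙 (opOpUnit C)) ≫
      (assocHom (dual (dual M)) (dual (dual N)) (opOpUnit C)) ≫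
      tensorHom (𝟙 (dual (dual M))) (counitNatIso N).hom ≫
        assocInv (dual (dual M)) (opOpUnit B) N ≫ tensorHom (counitNatIso M).hom (𝟙 N) ≫
          assocHom (opOpUnit A) M N :=
  hom_ext_doubleDual_left fun t c => lin_ext_apply
    ((counitNatIso (tensor M N)).hom.lin ∘ₗ (tm _ _).flip c ∘ₗ doubleDual (tensor M N))
    (Intertwiner.lin (tensorHom (doubleDualTensor M N) (𝟙 (opOpUnit C)) ≫
      (assocHom (dual (dual M)) (dual (dual N)) (opOpUnit C)) ≫
      tensorHom (𝟙 (dual (dual M))) (counitNatIso N).hom ≫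
        assocInv (dual (dual M)) (opOpUnit B) N ≫ tensorHom (counitNatIso M).hom (𝟙 N) ≫
          assocHom (opOpUnit A) M N) ∘ₗ (tm _ _).flip c ∘ₗ doubleDual (tensor M N))
    (fun m n => by
      refine (counitNatIso_hom_doubleDual (tensor M N) (tm M N m n) c).trans ?_
      change _ = (assocHom (opOpUnit A) M N).lin ((tensorHom (counitNatIso M).hom (𝟙 N)).lin
        ((assocInv (dual (dual M)) (opOpUnit B) N).lin
        ((tensorHom (𝟙 (dual (dual M))) (counitNatIso N).hom).lin
          ((assocHom (dual (dual M)) (dual (dual N)) (opOpUnit C)).lin (tm _ _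
            ((doubleDualTensor M N).lin (doubleDual _ (tm M N m n))) c)))))
      rw [doubleDualTensor_doubleDual]
      change _ = (assocHom (opOpUnit A) M N).lin ((tensorHom (counitNatIso M).hom (𝟙 N)).lin
        ((assocInv (dual (dual M)) (opOpUnit B) N).lin
        (tm (dual (dual M)) _ (doubleDual M m) ((counitNatIso N).hom.lin (tm (dual (dual N)) _
          (doubleDual N n) c)))))
      rw [counitNatIso_hom_doubleDual]
      change _ = (assocHom (opOpUnit A) M N).lin (tm _ _ ((counitNatIso M).hom.lin
        (tm (dual (dual M)) _ (doubleDual M m) _)) _)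
      rw [counitNatIso_hom_doubleDual]
      simp) t

/-! ### The two transformations are mutually inverse. -/

/-- The isomorphism `A ≅ A ⊗_{A°°} A`. -/
def unitIso (A : SSAlg.{v} k) : unit A ≅ tensor (unitOpOp A) (opOpUnit A) where
  hom :=
    { lin := (tm (unitOpOp A) (opOpUnit A)).flip (ofAlgOpOp A 1) ∘ₗ (ofAlg' A).toLinearMap ∘ₗ
        (ofAlg A).symm.toLinearMap
      map_lact := fun a x => rfl
      map_ract := fun a x => by
        change tm (unitOpOp A) (opOpUnit A) (ofAlg' A ((ofAlg A).symm x * a)) (ofAlgOpOp A 1) =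
          tm (unitOpOp A) (opOpUnit A) (ofAlg' A ((ofAlg A).symm x)) (ofAlgOpOp A (1 * a))
        have := tm_bal (M := unitOpOp A) (N := opOpUnit A) (ofAlg' A ((ofAlg A).symm x))
          (A.opp.toOpp (A.toOpp a)) (ofAlgOpOp A 1)
        simpa using this }
  inv := desc
    (LinearMap.mk₂ k (fun a b => ofAlg A ((ofAlg' A).symm a * (ofAlgOpOp A).symm b))
      (fun _ _ _ => by simp [add_mul]) (fun _ _ _ => by simp)
      (fun _ _ _ => by simp [mul_add]) (fun _ _ _ => by simp))
    (fun _ _ _ => by simp [mul_assoc]) (fun _ _ _ => by simp [mul_assoc])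
    (fun _ _ _ => by simp [mul_assoc])
  hom_inv_id := hom_ext (LinearMap.ext fun x => mul_one (M := A) x)
  inv_hom_id := hom_ext₂ fun a b => by
    have := tm_bal (M := unitOpOp A) (N := opOpUnit A) a
      (A.opp.toOpp (A.toOpp ((ofAlgOpOp A).symm b))) (ofAlgOpOp A 1)
    rw [lact_ofAlgOpOp] at this
    simp only [LinearEquiv.symm_apply_apply, mul_one, LinearEquiv.apply_symm_apply] at this
    exact this

/-- The isomorphism `A ⊗_A A ≅ A°°`. -/
def counitIso (A : SSAlg.{v} k) : tensor (opOpUnit A) (unitOpOp A) ≅ unit A.opp.opp where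
  hom := desc
    (LinearMap.mk₂ k (fun a b => ofAlg A.opp.opp (A.opp.toOpp (A.toOpp
        ((ofAlgOpOp A).symm a * (ofAlg' A).symm b))))
      (fun _ _ _ => by simp [add_mul]) (fun _ _ _ => by simp)
      (fun _ _ _ => by simp [mul_add]) (fun _ _ _ => by simp))
    (fun _ _ _ => by simp [mul_assoc]) (fun _ _ _ => by simp [mul_assoc])
    (fun _ _ _ => by simp [mul_assoc])
  inv :=
    { lin := (tm (opOpUnit A) (unitOpOp A)).flip (ofAlg' A 1) ∘ₗ (ofAlgOpOp A).toLinearMap ∘ₗ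
        A.toOpp.symm.toLinearMap ∘ₗ A.opp.toOpp.symm.toLinearMap ∘ₗ
        (ofAlg A.opp.opp).symm.toLinearMap
      map_lact := fun a x => rfl
      map_ract := fun a x => by
        have := tm_bal (M := opOpUnit A) (N := unitOpOp A)
          (ofAlgOpOp A (A.toOpp.symm (A.opp.toOpp.symm ((ofAlg A.opp.opp).symm x))))
          (A.toOpp.symm (A.opp.toOpp.symm a)) (ofAlg' A 1)
        simp only [ract_ofAlgOpOp, lact_ofAlg', mul_one] at this
        refine this.trans ?_
        exact congrArg (tm (opOpUnit A) (unitOpOp A) _) (one_mul (M := A) _).symm }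
  hom_inv_id := hom_ext₂ fun a b => by
    have := tm_bal (M := opOpUnit A) (N := unitOpOp A) a ((ofAlg' A).symm b) (ofAlg' A 1)
    rw [lact_ofAlg', mul_one] at this
    exact this
  inv_hom_id := hom_ext (LinearMap.ext fun x =>
    congrArg (fun a => ofAlg A.opp.opp (A.opp.toOpp (A.toOpp a)))
      (mul_one (A.toOpp.symm (A.opp.toOpp.symm ((ofAlg A.opp.opp).symm x)))))

/-- This is the modification law for `unitIso`: both composites send `m ⊗ b` to `(1 ⊗ 1) ⊗ mb`. -/
theorem unitIso_naturality (M : BiMod A B) :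
    tensorHom (𝟙 M) (unitIso B).hom ≫ assocInv M (unitOpOp B) (opOpUnit B) ≫
      tensorHom (unitNat M) (𝟙 (opOpUnit B)) ≫
        assocHom (unitOpOp A) (dual (dual M)) (opOpUnit B) ≫
          tensorHom (𝟙 (unitOpOp A)) (counitNatIso M).hom ≫
            assocInv (unitOpOp A) (opOpUnit A) M =
      ((runit M).hom ≫ (lunit M).inv) ≫ tensorHom (unitIso A).hom (𝟙 M) :=
  hom_ext₂ fun m b => by
    refine (congrArg (fun t => (assocInv (unitOpOp A) (opOpUnit A) M).lin
      (tm (unitOpOp A) _ (ofAlg' A 1) t)) (counitNatIso_hom_doubleDual M _ _)).trans ?_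
    change (assocInv (unitOpOp A) (opOpUnit A) M).lin (tm (unitOpOp A) _ (ofAlg' A 1)
      (tm (opOpUnit A) M (ofAlgOpOp A 1) (M.ract 1 (M.ract ((ofAlg B).symm b) m)))) = _
    rw [ract_one]
    rfl

/-- This is the modification law for `counitIso`: on `ψ(m) ⊗ (a ⊗ b)` both composites give `1 ⊗
ψ(mab)`. -/
theorem counitIso_naturality (M : BiMod A B) :
    tensorHom (𝟙 (dual (dual M))) (counitIso B).hom ≫ (runit (dual (dual M))).hom ≫
        (lunit (dual (dual M))).inv =
      (assocInv (dual (dual M)) (opOpUnit B) (unitOpOp B) ≫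
      tensorHom (counitNatIso M).hom (𝟙 (unitOpOp B)) ≫
        assocHom (opOpUnit A) M (unitOpOp B) ≫
          tensorHom (𝟙 (opOpUnit A)) (unitNat M) ≫
            assocInv (opOpUnit A) (unitOpOp A) (dual (dual M))) ≫
              tensorHom (counitIso A).hom (𝟙 (dual (dual M))) :=
  hom_ext₃' fun F a b => by
    obtain ⟨m, rfl⟩ := (doubleDual_bijective M).2 F
    refine Eq.trans ?_ (congrArg (fun t => (tensorHom (counitIso A).hom (𝟙 (dual (dual M)))).lin
      ((assocInv (opOpUnit A) (unitOpOp A) (dual (dual M))).lin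
        ((tensorHom (𝟙 (opOpUnit A)) (unitNat M)).lin ((assocHom (opOpUnit A) M (unitOpOp B)).lin
          (tm _ (unitOpOp B) t b))))) (counitNatIso_hom_doubleDual M m a)).symm
    change tm (unit A.opp.opp) (dual (dual M)) (ofAlg A.opp.opp 1) ((dual (dual M)).ract
      (B.opp.toOpp (B.toOpp ((ofAlgOpOp B).symm a * (ofAlg' B).symm b))) (doubleDual M m)) =
        tm (unit A.opp.opp) (dual (dual M)) (ofAlg A.opp.opp (A.opp.toOpp (A.toOpp (1 * 1))))
          (doubleDual M (M.ract ((ofAlg' B).symm b) (M.ract ((ofAlgOpOp B).symm a) m)))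
    rw [← doubleDual_ract, ract_mul, one_mul]
    rfl

/-! ### The modification law for `ζ` and the coherence law. -/

theorem unitNatIso_inv_doubleDual (M : BiMod A B) (a : unitOpOp A) (m : M) :
    (unitNatIso M).inv.lin (tm (unitOpOp A) (dual (dual M)) a (doubleDual M m)) =
      tm M (unitOpOp B) (M.lact ((ofAlg' A).symm a) m) (ofAlg' B 1) := by
  change tm M (unitOpOp B) (M.lact ((ofAlg' A).symm a)
    ((doubleDualEquiv M).symm (doubleDual M m))) (ofAlg' B 1) = _
  rw [doubleDualEquiv_symm_doubleDual]

/-- The inverse of `unitNatIso` appears because the cell of `y` at `M` is read in the bicategory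
with reversed 2-morphisms. The images of `f ⊗ x`, evaluated at `a ⊗ ψ(m)`, are both `x f(am)`. The
remaining inverse constraint is moved to the other side, so that both sides are explicit. -/
theorem zetaHom_dualTensor (M : BiMod A B) :
    tensorHom (𝟙 (dual M)) (zetaHom B) ≫ dualTensor M (unitOpOp B) ≫
        dualMap (unitNatIso M).inv =
      (unitNat (dual M) ≫ tensorHom (zetaHom A) (𝟙 (dual (dual (dual M))))) ≫
        dualTensor (unitOpOp A) (dual (dual M)) :=
  hom_ext₂ fun f x => dual_tensor_ext fun a F => by
    obtain ⟨m, rfl⟩ := (doubleDual_bijective M).2 F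
    refine (congrArg (ev (tensor M (unitOpOp B)) (dualPair M (unitOpOp B) f ((zetaHom B).lin x)))
      (unitNatIso_inv_doubleDual M a m)).trans ?_
    change B.opp.toOpp (B.toOpp (B.toOpp.symm ((ofAlg' B.opp).symm x) *
        (ev M f (M.lact ((ofAlg' A).symm a) m) * 1))) =
      B.opp.toOpp (B.toOpp (B.toOpp.symm ((ofAlg' B.opp).symm x) *
        ev M f (M.lact (1 * (ofAlg' A).symm a) m)))
    rw [mul_one, one_mul]

theorem zetaIso_naturality (M : BiMod A B) :
    tensorHom (𝟙 (dual M)) (zetaHom B) ≫ dualTensor M (unitOpOp B) ≫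
        dualMap (unitNatIso M).inv ≫ (dualTensorIso (unitOpOp A) (dual (dual M))).inv =
      unitNat (dual M) ≫ tensorHom (zetaHom A) (𝟙 (dual (dual (dual M)))) := by
  have h := (dualTensorIso (unitOpOp A) (dual (dual M))).comp_inv_eq.2 (zetaHom_dualTensor M)
  simpa only [Category.assoc] using h

/-- The left side is `a ⊗ (x ↦ xb)` and the right side is `1 ⊗ (x ↦ x(ab))`. Moving `a` across the
tensor sign turns the first into `1 ⊗ (x ↦ (xa)b)`. -/
theorem zetaHom_coherence (A : SSAlg.{v} k) :
    tensorHom (𝟙 (unitOpOp A)) (zetaHom A.opp) =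
      unitNat (unitOpOp A) ≫ tensorHom (𝟙 (unitOpOp A)) (dualMap (zetaHom A)) :=
  hom_ext₂ fun a b => by
    change tm (unitOpOp A) (dual (unitOpOp A.opp)) a (mulBy A.opp ((ofAlg' A.opp.opp).symm b)) =
      tm (unitOpOp A) (dual (unitOpOp A.opp)) (ofAlg' A 1) ((dualMap (zetaHom A)).lin
        (doubleDual (unitOpOp A) (ofAlg' A ((ofAlg' A).symm a *
          A.toOpp.symm (A.opp.toOpp.symm ((ofAlg' A.opp.opp).symm b))))))
    have h := tm_bal (M := unitOpOp A) (N := dual (unitOpOp A.opp)) (ofAlg' A 1)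
      (A.opp.toOpp (A.toOpp ((ofAlg' A).symm a))) (mulBy A.opp ((ofAlg' A.opp.opp).symm b))
    rw [ract_ofAlg', one_mul] at h
    refine h.trans (congrArg (tm (unitOpOp A) (dual (unitOpOp A.opp)) (ofAlg' A 1))
      (dual_ext fun x => congrArg (fun y => A.opp.opp.toOpp (A.opp.toOpp (A.toOpp y))) ?_))
    exact mul_assoc (A.toOpp.symm ((ofAlg' A.opp).symm x)) ((ofAlg' A).symm a)
      (A.toOpp.symm (A.opp.toOpp.symm ((ofAlg' A.opp.opp).symm b)))

end BiMod

open BiMod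

/-! ### Assembly of the duality involution. -/

variable (k : Type u) [Field k]

/-- The pseudofunctor which sends `A` to `Aᵒᵖ` and an `(A, B)`-bimodule `M` to
`hom_B(M, B)`. -/
noncomputable def circ : Co (SSAlg.{v} k) ⥤ᵖ SSAlg.{v} k where
  obj A := A.as.opp
  map M := dual (Co.unop1 M)
  map₂ η := dualMap (Quiver.Hom.unop η)
  map₂_id _ := rfl
  map₂_comp _ _ := rfl
  mapId A := dualUnitIso A.as
  mapComp M N := (dualTensorIso (Co.unop1 M) (Co.unop1 N)).symm
  map₂_whisker_left M _ _ η :=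
    ((dualTensorIso _ _).eq_inv_comp).2 (dualTensor_whiskerLeft (Co.unop1 M) (Quiver.Hom.unop η))
  map₂_whisker_right η N :=
    ((dualTensorIso _ _).eq_inv_comp).2 (dualTensor_whiskerRight (Quiver.Hom.unop η) (Co.unop1 N))
  -- Two inverse constraints have to be moved across: that of `M ⊗ N` with `P`, and that of `M` with
  -- `N` tensored with `P°`.
  map₂_associator M N P := ((dualTensorIso _ _).eq_inv_comp).2
    (((tensorIso (dualTensorIso (Co.unop1 M) (Co.unop1 N))
      (Iso.refl (dual (Co.unop1 P)))).eq_inv_comp).2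
        (dualTensor_assoc (Co.unop1 M) (Co.unop1 N) (Co.unop1 P)))
  map₂_left_unitor M := ((dualTensorIso _ _).eq_inv_comp).2 (dualTensor_lunit (Co.unop1 M))
  map₂_right_unitor M := ((dualTensorIso _ _).eq_inv_comp).2 (dualTensor_runit (Co.unop1 M))

/-- The pseudonatural transformation `1 ⟶ (-)°°`. -/
noncomputable def circUnit : Pseudofunctor.id (SSAlg.{v} k) ⟶ double (circ.{v} k) where
  app A := unitOpOp A
  naturality M := unitNatIso M
  naturality_naturality η := unitNat_naturality η
  naturality_id A := by
    -- The unit constraint of the identity pseudofunctor is an identity, so its whiskering has to be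
    -- inserted on the right-hand side.
    refine (unitNat_id A).trans ((Category.id_comp _).symm.trans ?_)
    exact congrArg (· ≫ _) (id_whiskerRight (𝟙 A) (unitOpOp A)).symm
  naturality_comp M N := by
    refine (unitNat_comp M N).trans ((Category.id_comp _).symm.trans ?_)
    exact congrArg (· ≫ _) (id_whiskerRight (M ≫ N) (unitOpOp _)).symm

/-- The inverse pseudonatural transformation `(-)°° ⟶ 1`. -/
noncomputable def circCounit : double (circ.{v} k) ⟶ Pseudofunctor.id (SSAlg.{v} k) where
  app A := opOpUnit A
  naturality M := counitNatIso M
  naturality_naturality η := counitNat_naturality η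
  naturality_id A := ((congrArg (_ ≫ ·) (whiskerLeft_id _ _)).trans (Category.comp_id _)).trans
    (counitNat_id A)
  naturality_comp M N :=
    ((congrArg (_ ≫ ·) (whiskerLeft_id _ _)).trans (Category.comp_id _)).trans
      (counitNat_comp M N)

/-- The adjoint equivalence `1 ≌ (-)°°`. -/
noncomputable def circEquiv : Pseudofunctor.id (SSAlg.{v} k) ≌ double (circ.{v} k) :=
  -- No triangle identity has to be checked: the counit is corrected so that they hold, while the
  -- forward transformation stays `circUnit`.
  Equivalence.mkOfAdjointifyCounit (f := circUnit k) (g := circCounit k)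
    (Pseudofunctor.StrongTrans.isoMk (fun A => unitIso A) fun M => unitIso_naturality M)
    (Pseudofunctor.StrongTrans.isoMk (fun A => counitIso A) fun M => counitIso_naturality M)

/-- The modification with components `Aᵒᵖ ≅ hom_A(A, A)`. -/
noncomputable def circZeta :
    whiskerObj (circ.{v} k) (circUnit k) ≅ whiskerMap (circ.{v} k) (circUnit k) :=
  Pseudofunctor.StrongTrans.isoMk (fun A => zetaIso A.as) fun M =>
    zetaIso_naturality (Co.unop1 M)

/-- The duality involution on the Morita bicategory. -/
noncomputable def circInvolution : WeakDualityInvolution (SSAlg.{v} k) where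
  dual := circ k
  y := circEquiv k
  zeta := circZeta k
  coherence A := zetaHom_coherence A

end MoritaTwo

theorem theorem5p1 (k : Type u) [Field k] [IsAlgClosed k] [CharZero k] :
    ∃ W : DualityInvolution.WeakDualityInvolution (MoritaTwo.SSAlg.{v} k),
      W.toData = MoritaTwo.circData.{v} k :=
  -- Each field agrees by definition: `y.hom` unfolds to `circUnit`, and the inverse of `mapComp` is
  -- `dualTensor`, because `circ` uses the symmetric isomorphism.
  ⟨MoritaTwo.circInvolution k, rfl⟩
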